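/- Let $d\ge 1$ and let $\mathbb H^d=\mathbb R^d\times\mathbb R^d\times\mathbb R$ be the Heisenberg group with group law $(p,q,t)(p',q',t')=(p+p',q+q',t+t'+p\cdot q')$ and Lebesgue measure as Haar measure. For $\lambda\in\mathbb R\setminus\{0\}$ let $\Pi_\lambda$ be the Schrödinger representation on $L^2(\mathbb R^d)$, $$\Pi_\lambda(p,q,t)f(y)=e^{2\pi i\lambda t}e^{-2\pi i\lambda q\cdot y}f(y-p),$$ and let $\mathcal F\varphi(\lambda)=\int_{\mathbb H^d}\varphi(x)\Pi_\lambda(x)\,dx$ be the operator-valued Fourier transform, defined on $L^1\cap L^2(\mathbb H^d)$ and extended by continuity to $L^2(\mathbb H^d)$, with values in $L^2(\mathbb R,\mathcal{HS}(L^2(\mathbb R^d)),|\lambda|^d d\lambda)$, where $\mathcal{HS}$ denotes the Hilbert-Schmidt operators. For $\varphi,\psi\in L^2(\mathbb H^d)$ and a.e. $\alpha\in(0,1]$ put $$[\varphi,\psi](\alpha)=\sum_{j\in\mathbb Z}\langle\mathcal F\varphi(\alpha+j),\mathcal F\psi(\alpha+j)\rangle_{\mathcal{HS}}\,|\alpha+j|^d,\qquad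 E_\psi=\{\alpha\in(0,1]:[\psi,\psi](\alpha)>0\}.$$ Let $L_g\psi(x)=\psi(g^{-1}x)$ denote left translation. Let $\mathbb A,\mathbb B\in GL(d,\mathbb R)$ be such that $\mathbb A^t\mathbb B$ has integer entries, so that (with $\mathbb Z^d$ consisting of column vectors) $\Gamma=\mathbb A\mathbb Z^d\times\mathbb B\mathbb Z^d\times\mathbb Z$ is a subgroup of $\mathbb H^d$, and let $\Gamma_1=\mathbb A\mathbb Z^d\times\mathbb B\mathbb Z^d$, identified with $\mathbb A\mathbb Z^d\times\mathbb B\mathbb Z^d\times\{0\}\subset\Gamma$. Theorem 1.3. Let $\psi\in L^2(\mathbb H^d)$, $\psi\neq0$, and assume that for every $\gamma_1\in\Gamma_1\setminus\{0\}$ $$[\psi,L_{\gamma_1}\psi](\alpha)=0\quad\text{for a.e. }\alpha\in E_\psi .$$ Then for all real $0<A\le B<\infty$ the following are equivalent: a) $\{L_\gamma\psi\}_{\gamma\in\Gamma}$ is a Riesz basis with constants $A$ and $B$ of its closed linear span in $L^2(\mathbb H^d)$; that is, it is an (unconditional) basis of the closed span, and for every $\{a_\gamma\}\in\ell^2(\Gamma)$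 the series $\sum_\gamma a_\gamma L_\gamma\psi$ converges in $L^2(\mathbb H^d)$ and $$A\sum_{\gamma\in\Gamma}|a_\gamma|^2\le\Big\|\sum_{\gamma\in\Gamma}a_\gamma L_\gamma\psi\Big\|^2_{L^2(\mathbb H^d)}\le B\sum_{\gamma\in\Gamma}|a_\gamma|^2 ;$$ b) $A\le[\psi,\psi](\alpha)\le B$ for a.e. $\alpha\in(0,1]$. -/

import Mathlib

open MeasureTheory Filter Topology Set
open scoped ENNReal Matrix

noncomputable section

/-! ### The Heisenberg group -/

/-- The `d`-dimensional polarized Heisenberg group `ℝᵈ × ℝᵈ × ℝ`. -/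
def Heis (d : ℕ) : Type :=
  EuclideanSpace ℝ (Fin d) × EuclideanSpace ℝ (Fin d) × ℝ

namespace Heis

variable {d : ℕ}

/-- The element `(p, q, t)`. -/
def mk (p q : EuclideanSpace ℝ (Fin d)) (t : ℝ) : Heis d := (p, q, t)

/-- The first component of `(p, q, t)`. -/
def p (x : Heis d) : EuclideanSpace ℝ (Fin d) := Prod.fst x

/-- The second component of `(p, q, t)`. -/
def q (x : Heis d) : EuclideanSpace ℝ (Fin d) := Prod.fst (Prod.snd x)

/-- The central component of `(p, q, t)`. -/
def t (x : Heis d) : ℝ := Prod.snd (Prod.snd x)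

@[simp] theorem mk_p (p q : EuclideanSpace ℝ (Fin d)) (t : ℝ) : (mk p q t).p = p := rfl
@[simp] theorem mk_q (p q : EuclideanSpace ℝ (Fin d)) (t : ℝ) : (mk p q t).q = q := rfl
@[simp] theorem mk_t (p q : EuclideanSpace ℝ (Fin d)) (t : ℝ) : (mk p q t).t = t := rfl

theorem ext' {x y : Heis d} (hp : x.p = y.p) (hq : x.q = y.q) (ht : x.t = y.t) : x = y :=
  Prod.ext hp (Prod.ext hq ht)

/-- The Haar measure: Lebesgue measure on `ℝᵈ × ℝᵈ × ℝ`. -/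
instance instMeasureSpace : MeasureSpace (Heis d) :=
  inferInstanceAs
    (MeasureSpace (EuclideanSpace ℝ (Fin d) × EuclideanSpace ℝ (Fin d) × ℝ))

/-- `(p,q,t)(p',q',t') = (p + p', q + q', t + t' + p·q')`. -/
instance instMul : Mul (Heis d) :=
  ⟨fun x y => mk (x.p + y.p) (x.q + y.q) (x.t + y.t + inner ℝ x.p y.q)⟩

instance instOne : One (Heis d) := ⟨mk 0 0 0⟩

/-- `(p,q,t)⁻¹ = (-p, -q, -t + p·q)`. -/
instance instInv : Inv (Heis d) := ⟨fun x => mk (-x.p) (-x.q) (-x.t + inner ℝ x.p x.q)⟩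

@[simp] theorem mul_p (x y : Heis d) : (x * y).p = x.p + y.p := rfl
@[simp] theorem mul_q (x y : Heis d) : (x * y).q = x.q + y.q := rfl
@[simp] theorem mul_t (x y : Heis d) : (x * y).t = x.t + y.t + inner ℝ x.p y.q := rfl
@[simp] theorem one_p : (1 : Heis d).p = 0 := rfl
@[simp] theorem one_q : (1 : Heis d).q = 0 := rfl
@[simp] theorem one_t : (1 : Heis d).t = 0 := rfl
@[simp] theorem inv_p (x : Heis d) : (x⁻¹).p = -x.p := rfl
@[simp] theorem inv_q (x : Heis d) : (x⁻¹).q = -x.q := rfl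
@[simp] theorem inv_t (x : Heis d) : (x⁻¹).t = -x.t + inner ℝ x.p x.q := rfl

instance instGroup : Group (Heis d) :=
  Group.ofLeftAxioms
    (fun x y z => by
      refine ext' ?_ ?_ ?_
      · simp [add_assoc]
      · simp [add_assoc]
      · simp [inner_add_left, inner_add_right]; ring)
    (fun x => by refine ext' ?_ ?_ ?_ <;> simp)
    (fun x => by refine ext' ?_ ?_ ?_ <;> simp)

theorem measurePreserving_mul_left (g : Heis d) :
    MeasurePreserving (fun x : Heis d => g * x) volume volume := by
  have h2 : MeasurePreserving
      (fun y : EuclideanSpace ℝ (Fin d) × ℝ => (g.q + y.1, g.t + y.2 + inner ℝ g.p y.1))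
      volume volume := by
    refine MeasurePreserving.skew_product (measurePreserving_add_left volume g.q)
      (g := fun a s => g.t + s + inner ℝ g.p a) (by fun_prop) (ae_of_all _ fun a => ?_)
    have : (fun s : ℝ => g.t + s + inner ℝ g.p a) = fun s => (g.t + inner ℝ g.p a) + s := by
      funext s; ring
    rw [this]
    exact (measurePreserving_add_left volume _).map_eq
  exact (measurePreserving_add_left volume g.p).prod h2

end Heis

/-- `L²(ℍᵈ)`. -/
abbrev L2Heis (d : ℕ) : Type := Lp ℂ 2 (volume : Measure (Heis d))

/-- `L²(ℝᵈ)`. -/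
abbrev L2Euc (d : ℕ) : Type := Lp ℂ 2 (volume : Measure (EuclideanSpace ℝ (Fin d)))

/-- Left translation `L_g ψ (x) = ψ (g⁻¹ x)` on `L²(ℍᵈ)`. -/
def leftTranslate {d : ℕ} (g : Heis d) (ψ : L2Heis d) : L2Heis d :=
  Lp.compMeasurePreserving (fun x => g⁻¹ * x) (Heis.measurePreserving_mul_left g⁻¹) ψ

/-! ### Schrödinger representations and the operator-valued Fourier transform -/

/-- The function `y ↦ e^{2πiλt} e^{-2πiλ q·y} f(y - p)`, where `x = (p, q, t)`. -/
def schrodingerFun {d : ℕ} (l : ℝ) (x : Heis d) (f : EuclideanSpace ℝ (Fin d) → ℂ)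
    (y : EuclideanSpace ℝ (Fin d)) : ℂ :=
  Complex.exp (((2 * Real.pi * l * x.t : ℝ) : ℂ) * Complex.I) *
    Complex.exp (((-(2 * Real.pi * l * inner ℝ x.q y) : ℝ) : ℂ) * Complex.I) * f (y - x.p)

theorem memLp_schrodingerFun {d : ℕ} (l : ℝ) (x : Heis d) (f : L2Euc d) :
    MemLp (schrodingerFun l x f) 2 volume := by
  have h1 : MemLp (fun y => f (y - x.p)) 2 volume :=
    (Lp.memLp f).comp_measurePreserving (measurePreserving_sub_right volume x.p)
  refine h1.of_le ?_ (ae_of_all _ fun y => ?_)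
  · have hc : Continuous fun y : EuclideanSpace ℝ (Fin d) =>
        Complex.exp (((2 * Real.pi * l * x.t : ℝ) : ℂ) * Complex.I) *
        Complex.exp (((-(2 * Real.pi * l * inner ℝ x.q y) : ℝ) : ℂ) * Complex.I) := by
      fun_prop
    exact hc.aestronglyMeasurable.mul h1.1
  · simp only [schrodingerFun, norm_mul, Complex.norm_exp_ofReal_mul_I, one_mul, le_refl]

/-- The Schrödinger representation `Π_λ(x)` on `L²(ℝᵈ)`:
`Π_λ(p,q,t) f(y) = e^{2πiλt} e^{-2πiλ q·y} f(y - p)`. -/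
def schrodinger {d : ℕ} (l : ℝ) (x : Heis d) (f : L2Euc d) : L2Euc d :=
  (memLp_schrodingerFun l x f).toLp (schrodingerFun l x f)

/-- The Fourier transform `∫ φ(x) Π_λ(x) dx` at `λ` of an integrable function `φ` on `ℍᵈ`, as a
strong operator integral: it maps `f ∈ L²(ℝᵈ)` to the `L²(ℝᵈ)`-valued Bochner integral
`∫ φ(x) Π_λ(x) f dx`. -/
def fourierL1 {d : ℕ} (φ : Heis d → ℂ) (l : ℝ) (f : L2Euc d) : L2Euc d :=
  ∫ x : Heis d, φ x • schrodinger l x f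

/-- Index set of an orthonormal basis of `L²(ℝᵈ)`. -/
def hsIndex (d : ℕ) : Set (L2Euc d) := (exists_hilbertBasis ℂ (L2Euc d)).choose

/-- An orthonormal basis of `L²(ℝᵈ)`; Hilbert-Schmidt inner products and norms do not depend on
which one is used. -/
def hsBasis (d : ℕ) : HilbertBasis (hsIndex d) ℂ (L2Euc d) :=
  (exists_hilbertBasis ℂ (L2Euc d)).choose_spec.choose

/-- The square `∑ᵢ ‖S eᵢ‖²` of the Hilbert-Schmidt norm of `S`, possibly infinite. -/
def hsNormSq {d : ℕ} (S : L2Euc d → L2Euc d) : ℝ≥0∞ :=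
  ∑' i : hsIndex d, ‖S (hsBasis d i)‖ₑ ^ 2

/-- The Hilbert-Schmidt inner product `⟨S, T⟩ = trace (S T†) = trace (T† S) = ∑ᵢ ⟨S eᵢ, T eᵢ⟩`,
linear in `S`. (Mathlib's `inner` is conjugate-linear in its first argument.) -/
def hsInner {d : ℕ} (S T : L2Euc d →L[ℂ] L2Euc d) : ℂ :=
  ∑' i : hsIndex d, inner ℂ (T (hsBasis d i)) (S (hsBasis d i))

/-- `T` is (a representative of) the Fourier transform of `φ ∈ L²(ℍᵈ)`: it is the limit, in
`L²(ℝ, HS(L²(ℝᵈ)), |λ|ᵈ dλ)`, of the Fourier transforms of a sequence in `L¹ ∩ L²`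
converging to `φ` in `L²`. This is the extension by continuity of the Fourier transform from
`L¹ ∩ L²` to `L²`, and it determines `T(λ)` for almost every `λ`. -/
def IsFourierTransform {d : ℕ} (φ : L2Heis d) (T : ℝ → (L2Euc d →L[ℂ] L2Euc d)) : Prop :=
  (∀ f : L2Euc d, AEStronglyMeasurable (fun l => T l f) volume) ∧
  ∃ u : ℕ → L2Heis d,
    (∀ n, Integrable (u n) volume) ∧
    Tendsto u atTop (𝓝 φ) ∧
    Tendsto (fun n => ∫⁻ l : ℝ,
      hsNormSq (fun f => fourierL1 (u n) l f - T l f) * ENNReal.ofReal (|l| ^ d)) atTop (𝓝 0)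

open Classical in
/-- The Fourier transform `λ ↦ 𝓕φ(λ)` of `φ ∈ L²(ℍᵈ)` (a representative of its a.e. class). -/
def heisFourier {d : ℕ} (φ : L2Heis d) : ℝ → (L2Euc d →L[ℂ] L2Euc d) :=
  if h : ∃ T, IsFourierTransform φ T then h.choose else 0

/-! ### The bracket -/

/-- The bracket `[φ, ψ](α) = ∑_{j ∈ ℤ} ⟨𝓕φ(α + j), 𝓕ψ(α + j)⟩_HS |α + j|ᵈ`. -/
def bracket {d : ℕ} (φ ψ : L2Heis d) (α : ℝ) : ℂ :=
  ∑' j : ℤ, hsInner (heisFourier φ (α + j)) (heisFourier ψ (α + j)) * ((|α + j| ^ d : ℝ) : ℂ)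

/-- `E_ψ = {α ∈ (0,1] : [ψ,ψ](α) > 0}`; the bracket `[ψ,ψ](α)` is real. -/
def bracketSupport {d : ℕ} (ψ : L2Heis d) : Set ℝ :=
  {α | α ∈ Ioc (0 : ℝ) 1 ∧ 0 < (bracket ψ ψ α).re}

/-! ### Lattices -/

/-- The vector `A m ∈ ℝᵈ` for a real matrix `A` and an integer column vector `m`. -/
def latticeVec {d : ℕ} (A : Matrix (Fin d) (Fin d) ℝ) (m : Fin d → ℤ) :
    EuclideanSpace ℝ (Fin d) :=
  WithLp.toLp 2 (A *ᵥ fun i => (m i : ℝ))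

theorem latticeVec_add {d : ℕ} (A : Matrix (Fin d) (Fin d) ℝ) (m n : Fin d → ℤ) :
    latticeVec A (m + n) = latticeVec A m + latticeVec A n := by
  rw [latticeVec, latticeVec, latticeVec, ← WithLp.toLp_add, ← Matrix.mulVec_add]
  congr 2
  funext i
  simp

theorem latticeVec_neg {d : ℕ} (A : Matrix (Fin d) (Fin d) ℝ) (m : Fin d → ℤ) :
    latticeVec A (-m) = -latticeVec A m := by
  rw [latticeVec, latticeVec, ← WithLp.toLp_neg, ← Matrix.mulVec_neg]
  congr 2
  funext i
  simp

theorem inner_latticeVec {d : ℕ} (A B : Matrix (Fin d) (Fin d) ℝ)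
    (h : ∀ i j, ∃ k : ℤ, (Aᵀ * B) i j = k) (m n : Fin d → ℤ) :
    ∃ k : ℤ, inner ℝ (latticeVec A m) (latticeVec B n) = (k : ℝ) := by
  choose N hN using h
  refine ⟨m ⬝ᵥ ((Matrix.of N) *ᵥ n), ?_⟩
  have e : inner ℝ (latticeVec A m) (latticeVec B n)
      = (fun i => (m i : ℝ)) ⬝ᵥ ((Aᵀ * B) *ᵥ fun i => (n i : ℝ)) := by
    rw [← Matrix.mulVec_mulVec, Matrix.dotProduct_mulVec, Matrix.vecMul_transpose,
      dotProduct_comm]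
    simp [latticeVec, EuclideanSpace.inner_toLp_toLp]
  rw [e]
  simp [dotProduct, Matrix.mulVec, hN]

/-- The subgroup `Γ = Aℤᵈ × Bℤᵈ × ℤ` of `ℍᵈ`. With `ℤᵈ` consisting of column vectors, it is
closed under multiplication because `Aᵀ B` has integer entries. -/
def heisLattice {d : ℕ} (A B : Matrix (Fin d) (Fin d) ℝ)
    (h : ∀ i j, ∃ k : ℤ, (Aᵀ * B) i j = k) : Subgroup (Heis d) where
  carrier := {x | ∃ (m n : Fin d → ℤ) (k : ℤ), x = Heis.mk (latticeVec A m) (latticeVec B n) k}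
  mul_mem' := by
    rintro _ _ ⟨m, n, k, rfl⟩ ⟨m', n', k', rfl⟩
    obtain ⟨c, hc⟩ := inner_latticeVec A B h m n'
    refine ⟨m + m', n + n', k + k' + c, Heis.ext' ?_ ?_ ?_⟩
    · simp [latticeVec_add]
    · simp [latticeVec_add]
    · simp [hc]
  one_mem' := ⟨0, 0, 0, Heis.ext' (by simp [latticeVec, ← Pi.zero_def])
    (by simp [latticeVec, ← Pi.zero_def]) (by simp)⟩
  inv_mem' := by
    rintro _ ⟨m, n, k, rfl⟩
    obtain ⟨c, hc⟩ := inner_latticeVec A B h m n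
    refine ⟨-m, -n, -k + c, Heis.ext' ?_ ?_ ?_⟩
    · simp [latticeVec_neg]
    · simp [latticeVec_neg]
    · simp [hc]

/-- `Γ₁ = Aℤᵈ × Bℤᵈ`, viewed inside `ℍᵈ` as `Aℤᵈ × Bℤᵈ × {0}`. -/
def heisLattice₁ {d : ℕ} (A B : Matrix (Fin d) (Fin d) ℝ) : Set (Heis d) :=
  {x | ∃ m n : Fin d → ℤ, x = Heis.mk (latticeVec A m) (latticeVec B n) 0}

/-! ### Riesz bases -/

/-- `v` is a Riesz basis, with constants `a` and `b`, of its closed linear span: it is an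
(unconditional) basis of the closed span and, for every `c ∈ ℓ²`, the series `∑ cᵢ vᵢ` converges
and `a ∑ |cᵢ|² ≤ ‖∑ cᵢ vᵢ‖² ≤ b ∑ |cᵢ|²`. -/
def IsRieszBasisOfSpan {ι H : Type*} [NormedAddCommGroup H] [InnerProductSpace ℂ H]
    (a b : ℝ) (v : ι → H) : Prop :=
  (∃ e : UnconditionalSchauderBasis ι ℂ (Submodule.span ℂ (range v)).topologicalClosure,
    ∀ i, ((e i : (Submodule.span ℂ (range v)).topologicalClosure) : H) = v i) ∧
  ∀ c : ι → ℂ, Summable (fun i => ‖c i‖ ^ 2) →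
    Summable (fun i => c i • v i) ∧
    a * ∑' i, ‖c i‖ ^ 2 ≤ ‖∑' i, c i • v i‖ ^ 2 ∧
    ‖∑' i, c i • v i‖ ^ 2 ≤ b * ∑' i, ‖c i‖ ^ 2

end

/-! The lattice splits into cosets `γ₁Z` of its central part `Z = {(0,0,k)}`, and `Π_λ` sends a
central element to the scalar `e^{2πiλk}`. By Plancherel, followed by folding the frequency line
onto `(0,1]`, a combination of central translates satisfies `‖∑ cₖ L_k ψ‖² = ∫ |∑ cₖ e^{2πikα}|²
[ψ,ψ](α) dα` over `(0,1]` (`norm_sum_central_sq`). Since `∫ |∑ cₖ e^{2πikα}|² = ∑ |cₖ|²`, bounds on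
the bracket give the Riesz inequalities on `Z`. Conversely, squared moduli of trigonometric
polynomials approximate indicators of compact sets, so the inequalities force the bounds almost
everywhere (`finiteRieszBounds_central_iff`).

For the full lattice, the Fourier coefficients of `[ψ, L_{γ₁}ψ]` are the inner products of `L_{γ₁}ψ`
with the central translates of `ψ`. The hypothesis kills this bracket on `E_ψ`, and off `E_ψ` it
vanishes by itself, so different cosets give orthogonal families
(`inner_leftTranslate_central_eq_zero`, `exists_mul_latticePoint`). Each coset is an isometric image
of the central one, and Pythagoras transfers the bounds (`FiniteRieszBounds.of_orthogonal_rows`).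
The converse restricts to `Z`.

Two tools support this. Being a Riesz basis of the closed span reduces to inequalities for finite
sums (`isRieszBasisOfSpan_iff_finiteRieszBounds`). The Plancherel theorem is proved by writing
`fourierL1 u l` as an integral operator whose kernel is a partial Fourier transform of `u`;
completeness then yields the transform on all of `L²` (`exists_isFourierTransform`). -/

open MeasureTheory Filter Topology Set
open scoped ENNReal Matrix

noncomputable section

/-! ### Euclidean Plancherel theorem for the Fourier integral -/

section Plancherel

open scoped FourierTransform SchwartzMap

variable {V : Type*} [NormedAddCommGroup V] [InnerProductSpace ℝ V] [FiniteDimensional ℝ V]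
  [MeasurableSpace V] [BorelSpace V]

/-- On `L¹ ∩ L²` the `L²` Fourier transform is given by the Fourier integral. -/
theorem fourier_toLp_ae_eq {f : V → ℂ} (hf : Integrable f) (hf2 : MemLp f 2) :
    ((𝓕 (hf2.toLp f) : Lp ℂ 2 (volume : Measure V)) : V → ℂ) =ᵐ[volume] 𝓕 f := by
  have hcont : Continuous (𝓕 f) :=
    VectorFourier.fourierIntegral_continuous (L := innerₗ V)
      Real.continuous_fourierChar continuous_inner hf
  -- Both sides are compared as distributions: against a test function the transform moves onto the
  -- test function, where the two definitions agree.
  refine ae_eq_of_integral_contDiff_smul_eq ((Lp.memLp _).locallyIntegrable one_le_two)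
    hcont.locallyIntegrable fun g hg hgc => ?_
  have hg₁ : HasCompactSupport (Complex.ofRealCLM ∘ g) := hgc.comp_left rfl
  have hg₂ : ContDiff ℝ (⊤ : ℕ∞) (Complex.ofRealCLM ∘ g) := by fun_prop
  set G : 𝓢(V, ℂ) := hg₁.toSchwartzMap hg₂ with hG
  have hGg : ∀ x, G x = (g x : ℂ) := fun x => rfl
  have e1 := DFunLike.congr_fun (Lp.fourier_toTemperedDistribution_eq (hf2.toLp f)) G
  rw [TemperedDistribution.fourier_apply, Lp.toTemperedDistribution_apply,
    Lp.toTemperedDistribution_apply] at e1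
  have e2 : ∫ ξ, 𝓕 (G : V → ℂ) ξ • f ξ = ∫ x, (G x) • 𝓕 f x := by
    simpa using! VectorFourier.integral_fourierIntegral_smul_eq_flip (L := innerₗ V)
      Real.continuous_fourierChar continuous_inner G.integrable hf
  have e3 : ∫ x, (𝓕 G) x • (hf2.toLp f : V → ℂ) x = ∫ ξ, 𝓕 (G : V → ℂ) ξ • f ξ := by
    refine integral_congr_ae ?_
    filter_upwards [hf2.coeFn_toLp] with x hx
    rw [hx, SchwartzMap.fourier_coe]
  calc ∫ x, g x • ((𝓕 (hf2.toLp f) : Lp ℂ 2 (volume : Measure V)) : V → ℂ) x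
      = ∫ x, G x • ((𝓕 (hf2.toLp f) : Lp ℂ 2 (volume : Measure V)) : V → ℂ) x := by
        simp [hGg]
    _ = ∫ x, G x • 𝓕 f x := by rw [← e1, e3, e2]
    _ = _ := by simp [hGg]

/-- Plancherel's theorem on `L¹ ∩ L²`. -/
theorem lintegral_enorm_fourier_sq {f : V → ℂ} (hf : Integrable f) (hf2 : MemLp f 2) :
    ∫⁻ x, ‖𝓕 f x‖ₑ ^ 2 = ∫⁻ x, ‖f x‖ₑ ^ 2 := by
  have h1 : eLpNorm (𝓕 f) 2 volume = eLpNorm f 2 volume := by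
    rw [← eLpNorm_congr_ae (fourier_toLp_ae_eq hf hf2), ← eLpNorm_congr_ae hf2.coeFn_toLp,
      ← Lp.enorm_def, ← Lp.enorm_def]
    simp only [← ofReal_norm, Lp.norm_fourier_eq]
  have h2 : ∀ g : V → ℂ, ∫⁻ x, ‖g x‖ₑ ^ 2 = eLpNorm g 2 volume ^ 2 := fun g => by
    simpa using (eLpNorm_nnreal_pow_eq_lintegral (p := 2) (f := g) (μ := volume)
      two_ne_zero).symm
  rw [h2, h2, h1]

end Plancherel

/-! ### `L²`-valued maps and Bochner integrals given by pointwise kernels -/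

section LpValued

variable {X Y : Type*} [MeasurableSpace X] [MeasurableSpace Y] {μ : Measure X} {ν : Measure Y}

theorem lintegral_enorm_sq_eq_eLpNorm {E : Type*} [NormedAddCommGroup E] (g : X → E) :
    ∫⁻ x, ‖g x‖ₑ ^ 2 ∂μ = eLpNorm g 2 μ ^ 2 := by
  simpa using (eLpNorm_nnreal_pow_eq_lintegral (p := 2) (f := g) (μ := μ) two_ne_zero).symm

theorem Lp.enorm_sq_eq_lintegral {E : Type*} [NormedAddCommGroup E] (g : Lp E 2 μ) :
    ‖g‖ₑ ^ 2 = ∫⁻ x, ‖g x‖ₑ ^ 2 ∂μ := by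
  rw [lintegral_enorm_sq_eq_eLpNorm, Lp.enorm_def]

/-- A map into `L²` with a jointly measurable representative is strongly measurable. -/
theorem stronglyMeasurable_Lp_of_uncurry [SFinite ν] [SecondCountableTopology (Lp ℂ 2 ν)]
    {k : X → Y → ℂ} (hk : StronglyMeasurable (Function.uncurry k)) {F : X → Lp ℂ 2 ν}
    (hF : ∀ x, F x =ᵐ[ν] k x) : StronglyMeasurable F := by
  -- Distances to a fixed vector are measurable by Tonelli; in a separable space this suffices,
  -- since open sets are countable unions of balls.
  have hd : ∀ g : Lp ℂ 2 ν, Measurable fun x => edist (F x) g := by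
    intro g
    have : (fun x => edist (F x) g) = fun x => (∫⁻ y, ‖k x y - g y‖ₑ ^ 2 ∂ν) ^ (2⁻¹ : ℝ) := by
      funext x
      rw [lintegral_enorm_sq_eq_eLpNorm, Lp.edist_def]
      rw [← ENNReal.rpow_natCast, ← ENNReal.rpow_mul]
      norm_num
      exact eLpNorm_congr_ae ((hF x).sub ae_eq_rfl)
    rw [this]
    have hg : StronglyMeasurable fun z : X × Y => k z.1 z.2 - g z.2 :=
      hk.sub ((Lp.stronglyMeasurable g).comp_measurable measurable_snd)
    exact ((hg.enorm.pow_const 2).lintegral_prod_right' (ν := ν)).pow_const _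
  let : MeasurableSpace (Lp ℂ 2 ν) := borel _
  have : BorelSpace (Lp ℂ 2 ν) := ⟨rfl⟩
  refine Measurable.stronglyMeasurable ?_
  refine measurable_of_isOpen fun U hU => ?_
  obtain ⟨D, hDc, hDd⟩ := TopologicalSpace.exists_countable_dense (Lp ℂ 2 ν)
  have : U = ⋃ p ∈ {p : (Lp ℂ 2 ν) × ℚ | p.1 ∈ D ∧ Metric.eball p.1 (ENNReal.ofReal p.2) ⊆ U},
      Metric.eball p.1 (ENNReal.ofReal p.2) := by
    refine Subset.antisymm (fun x hx => ?_) (iUnion₂_subset fun p hp => hp.2)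
    obtain ⟨ε, hε, hball⟩ := Metric.isOpen_iff.1 hU x hx
    obtain ⟨q, hq0, hqε⟩ := exists_rat_btwn (half_pos hε)
    obtain ⟨y, hyD, hy⟩ := hDd.exists_dist_lt x hq0
    refine mem_iUnion₂.2 ⟨(y, q), ⟨hyD, ?_⟩, ?_⟩
    · rw [Metric.eball_ofReal]
      refine Subset.trans (fun z hz => ?_) hball
      rw [Metric.mem_ball] at hz ⊢
      have := dist_triangle z y x
      rw [dist_comm y x] at this
      simp only at hz
      linarith
    · rw [Metric.eball_ofReal]
      exact hy
  rw [this, preimage_iUnion₂]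
  refine MeasurableSet.biUnion ?_ fun p _ => ?_
  · refine (hDc.prod (countable_univ (α := ℚ))).mono fun p hp => ?_
    exact ⟨hp.1, mem_univ _⟩
  · exact measurableSet_lt (hd p.1) measurable_const

/-- A Bochner integral in `L²` is almost everywhere the pointwise integral. -/
theorem coeFn_integral_Lp [SFinite μ] [SigmaFinite ν]
    {k : X → Y → ℂ} (hk : StronglyMeasurable (Function.uncurry k)) {F : X → Lp ℂ 2 ν}
    (hF : ∀ x, F x =ᵐ[ν] k x) (hFi : Integrable F μ) :
    (∀ᵐ y ∂ν, Integrable (fun x => k x y) μ) ∧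
      ((∫ x, F x ∂μ : Lp ℂ 2 ν) : Y → ℂ) =ᵐ[ν] fun y => ∫ x, k x y ∂μ := by
  -- On a set of finite measure `L²` embeds in `L¹`, so the kernel becomes integrable on the product
  -- and Fubini applies.
  have hprod : ∀ s, MeasurableSet s → ν s < ∞ →
      Integrable (Function.uncurry k) (μ.prod (ν.restrict s)) := by
    intro s hs hνs
    have : IsFiniteMeasure (ν.restrict s) := ⟨by simpa using hνs⟩
    have hmem : ∀ x, MemLp (k x) 2 (ν.restrict s) := fun x =>
      ((memLp_congr_ae (hF x)).1 (Lp.memLp _)).restrict s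
    rw [integrable_prod_iff hk.aestronglyMeasurable]
    refine ⟨ae_of_all _ fun x => (hmem x).integrable one_le_two, ?_⟩
    refine Integrable.mono' (hFi.norm.mul_const (((ν s) ^ (2⁻¹ : ℝ)).toReal))
      (hk.norm.integral_prod_right (ν := ν.restrict s)).aestronglyMeasurable (ae_of_all _ fun x => ?_)
    rw [Real.norm_of_nonneg (by positivity)]
    have h1 := eLpNorm_le_eLpNorm_mul_rpow_measure_univ (p := 1) (q := 2) one_le_two
      (hmem x).1
    have h2 : eLpNorm (k x) 2 (ν.restrict s) ≤ ‖F x‖ₑ := by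
      rw [Lp.enorm_def, eLpNorm_congr_ae (hF x)]
      exact eLpNorm_restrict_le _ _ _ _
    have h3 : ENNReal.ofReal (∫ y, ‖k x y‖ ∂(ν.restrict s)) = eLpNorm (k x) 1 (ν.restrict s) := by
      rw [eLpNorm_one_eq_lintegral_enorm,
        ofReal_integral_norm_eq_lintegral_enorm ((hmem x).integrable one_le_two)]
    rw [← ENNReal.ofReal_le_ofReal_iff (by positivity), ENNReal.ofReal_mul (norm_nonneg _),
      ofReal_norm, ENNReal.ofReal_toReal
        (ENNReal.rpow_ne_top_of_nonneg (by norm_num) hνs.ne)]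
    simp only [Function.uncurry_apply_pair]
    rw [h3]
    refine h1.trans ?_
    norm_num
    gcongr
  have hint : ∀ s, MeasurableSet s → ν s < ∞ → IntegrableOn (fun y => ∫ x, k x y ∂μ) s ν :=
    fun s hs hνs => (hprod s hs hνs).integral_prod_right
  constructor
  · refine ae_of_forall_measure_lt_top_ae_restrict _ fun s hs hνs => ?_
    exact (hprod s hs hνs).prod_left_ae
  · refine ae_eq_of_forall_setIntegral_eq_of_sigmaFinite (fun s hs hνs => ?_) hint
      fun s hs hνs => ?_
    · have : IsFiniteMeasure (ν.restrict s) := ⟨by simpa using hνs⟩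
      exact ((Lp.memLp _).restrict s).integrable one_le_two
    -- Integration over `s` is the inner product with its indicator, a continuous functional that
    -- passes through the Bochner integral.
    · have h4 := L2.inner_indicatorConstLp_one (𝕜 := ℂ) hs hνs.ne (∫ x, F x ∂μ)
      rw [← h4, ← integral_inner hFi]
      rw [← integral_integral_swap (hprod s hs hνs)]
      refine integral_congr_ae (ae_of_all _ fun x => ?_)
      simp only
      rw [L2.inner_indicatorConstLp_one (𝕜 := ℂ) hs hνs.ne]
      exact integral_congr_ae (ae_restrict_of_ae (hF x))

theorem HilbertBasis.tsum_enorm_inner_sq {ι H : Type*} [NormedAddCommGroup H]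
    [InnerProductSpace ℂ H] (b : HilbertBasis ι ℂ H) (x : H) :
    ∑' i, ‖(inner ℂ x (b i) : ℂ)‖ₑ ^ 2 = ‖x‖ₑ ^ 2 := by
  have h := b.hasSum_inner_mul_inner x x
  have h2 : HasSum (fun i => ‖(inner ℂ x (b i) : ℂ)‖ ^ 2) (‖x‖ ^ 2) := by
    have := (Complex.hasSum_re h)
    convert this using 1
    · funext i
      rw [← inner_conj_symm (b i) x, Complex.mul_conj, Complex.normSq_eq_norm_sq]
      simp only [Complex.ofReal_re]
    · exact (inner_self_eq_norm_sq (𝕜 := ℂ) x).symm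
  have h3 := ENNReal.ofReal_tsum_of_nonneg (fun i => by positivity) h2.summable
  rw [h2.tsum_eq] at h3
  simp only [ENNReal.ofReal_pow (norm_nonneg _), ofReal_norm] at h3
  exact h3.symm

end LpValued
end

/-! ### Plancherel formula on the Heisenberg group for `L¹ ∩ L²` -/

noncomputable section

section

variable {d : ℕ}

/-- Separability of `L²` is an instance conditional on a finite exponent. -/
instance fact_two_ne_top : Fact ((2 : ℝ≥0∞) ≠ ∞) := ⟨ENNReal.ofNat_ne_top⟩

instance Heis.sigmaFinite_volume : SigmaFinite (volume : Measure (Heis d)) :=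
  inferInstanceAs (SigmaFinite
    (volume : Measure (EuclideanSpace ℝ (Fin d) × EuclideanSpace ℝ (Fin d) × ℝ)))

theorem Heis.measurable_mk : Measurable
    fun z : EuclideanSpace ℝ (Fin d) × EuclideanSpace ℝ (Fin d) × ℝ => Heis.mk z.1 z.2.1 z.2.2 :=
  measurable_id

theorem Heis.measurable_p : Measurable (Heis.p : Heis d → _) :=
  (measurable_fst : Measurable
    (Prod.fst : EuclideanSpace ℝ (Fin d) × EuclideanSpace ℝ (Fin d) × ℝ → _))

theorem Heis.measurable_q : Measurable (Heis.q : Heis d → _) :=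
  (measurable_fst.comp measurable_snd : Measurable
    (fun z : EuclideanSpace ℝ (Fin d) × EuclideanSpace ℝ (Fin d) × ℝ => z.2.1))

theorem Heis.measurable_t : Measurable (Heis.t : Heis d → _) :=
  (measurable_snd.comp measurable_snd : Measurable
    (fun z : EuclideanSpace ℝ (Fin d) × EuclideanSpace ℝ (Fin d) × ℝ => z.2.2))

theorem Heis.lintegral_eq {g : Heis d → ℝ≥0∞} (hg : Measurable g) :
    ∫⁻ x, g x = ∫⁻ p, ∫⁻ q, ∫⁻ t, g (Heis.mk p q t) := by
  have h1 := lintegral_prod (μ := (volume : Measure (EuclideanSpace ℝ (Fin d))))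
    (ν := (volume : Measure (EuclideanSpace ℝ (Fin d) × ℝ)))
    (fun z => g (Heis.mk z.1 z.2.1 z.2.2)) (hg.comp Heis.measurable_mk).aemeasurable
  refine h1.trans (lintegral_congr fun p => ?_)
  exact lintegral_prod (μ := (volume : Measure (EuclideanSpace ℝ (Fin d))))
    (ν := (volume : Measure ℝ)) (fun z => g (Heis.mk p z.1 z.2))
    (hg.comp (Heis.measurable_mk.comp measurable_prodMk_left)).aemeasurable

theorem Heis.ae_integrable_slice {g : Heis d → ℂ} (hg : Integrable g) :
    ∀ᵐ p, Integrable fun z : EuclideanSpace ℝ (Fin d) × ℝ => g (Heis.mk p z.1 z.2) :=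
  Integrable.prod_right_ae (μ := (volume : Measure (EuclideanSpace ℝ (Fin d))))
    (ν := (volume : Measure (EuclideanSpace ℝ (Fin d) × ℝ)))
    (f := fun z => g (Heis.mk z.1 z.2.1 z.2.2)) hg

theorem Heis.integral_eq {g : Heis d → ℂ} (hg : Integrable g) :
    ∫ x, g x = ∫ p, ∫ q, ∫ t, g (Heis.mk p q t) := by
  have h1 := integral_prod (μ := (volume : Measure (EuclideanSpace ℝ (Fin d))))
    (ν := (volume : Measure (EuclideanSpace ℝ (Fin d) × ℝ)))
    (fun z => g (Heis.mk z.1 z.2.1 z.2.2)) hg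
  refine h1.trans (integral_congr_ae ?_)
  filter_upwards [Heis.ae_integrable_slice hg] with p hp
  exact integral_prod (μ := (volume : Measure (EuclideanSpace ℝ (Fin d))))
    (ν := (volume : Measure ℝ)) (fun z => g (Heis.mk p z.1 z.2)) hp

theorem stronglyMeasurable_schrodingerFun {f : EuclideanSpace ℝ (Fin d) → ℂ}
    (hf : StronglyMeasurable f) :
    StronglyMeasurable fun z : (ℝ × Heis d) × EuclideanSpace ℝ (Fin d) =>
      schrodingerFun z.1.1 z.1.2 f z.2 := by
  have h1 : Measurable fun z : (ℝ × Heis d) × EuclideanSpace ℝ (Fin d) => z.1.2.p :=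
    Heis.measurable_p.comp (measurable_snd.comp measurable_fst)
  have h2 : Measurable fun z : (ℝ × Heis d) × EuclideanSpace ℝ (Fin d) => z.1.2.q :=
    Heis.measurable_q.comp (measurable_snd.comp measurable_fst)
  have h3 : Measurable fun z : (ℝ × Heis d) × EuclideanSpace ℝ (Fin d) => z.1.2.t :=
    Heis.measurable_t.comp (measurable_snd.comp measurable_fst)
  unfold schrodingerFun
  refine StronglyMeasurable.mul ?_ (hf.comp_measurable (measurable_snd.sub h1))
  refine Measurable.stronglyMeasurable ?_
  fun_prop

theorem coeFn_schrodinger (l : ℝ) (x : Heis d) (f : L2Euc d) :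
    schrodinger l x f =ᵐ[volume] schrodingerFun l x f :=
  MemLp.coeFn_toLp _

theorem norm_schrodinger (l : ℝ) (x : Heis d) (f : L2Euc d) : ‖schrodinger l x f‖ = ‖f‖ := by
  have h1 : eLpNorm (schrodingerFun l x f) 2 volume = eLpNorm f 2 volume := by
    rw [← eLpNorm_comp_measurePreserving (Lp.aestronglyMeasurable f)
      (measurePreserving_sub_right volume x.p)]
    refine eLpNorm_congr_norm_ae (ae_of_all _ fun y => ?_)
    simp only [schrodingerFun, norm_mul, Complex.norm_exp_ofReal_mul_I, one_mul,
      Function.comp_apply]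
  rw [schrodinger, Lp.norm_toLp, h1, Lp.norm_def]

theorem stronglyMeasurable_smul_schrodinger {u : Heis d → ℂ} (hu : StronglyMeasurable u) (l : ℝ)
    (f : L2Euc d) : StronglyMeasurable fun x => u x • schrodinger l x f :=
  hu.smul <| stronglyMeasurable_Lp_of_uncurry (k := fun x y => schrodingerFun l x f y)
    ((stronglyMeasurable_schrodingerFun (Lp.stronglyMeasurable f)).comp_measurable
      (g := fun z : Heis d × EuclideanSpace ℝ (Fin d) => ((l, z.1), z.2)) (by fun_prop))
    fun x => coeFn_schrodinger l x f

theorem integrable_smul_schrodinger {u : Heis d → ℂ} (hu : Integrable u) (l : ℝ) (f : L2Euc d) :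
    Integrable fun x => u x • schrodinger l x f := by
  refine (hu.norm.mul_const ‖f‖).mono' ?_ (ae_of_all _ fun x => ?_)
  · obtain ⟨v, hv, huv⟩ := hu.1
    exact ⟨_, stronglyMeasurable_smul_schrodinger hv l f, by
      filter_upwards [huv] with x hx; simp [hx]⟩
  · rw [norm_smul, norm_schrodinger]

theorem fourierL1_congr {u v : Heis d → ℂ} (h : u =ᵐ[volume] v) : fourierL1 u = fourierL1 v := by
  funext l f
  exact integral_congr_ae (by filter_upwards [h] with x hx; simp [hx])

theorem fourierL1_add {u v : Heis d → ℂ} (hu : Integrable u) (hv : Integrable v) (l : ℝ)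
    (f : L2Euc d) : fourierL1 (u + v) l f = fourierL1 u l f + fourierL1 v l f := by
  rw [fourierL1, fourierL1, fourierL1,
    ← integral_add (integrable_smul_schrodinger hu l f) (integrable_smul_schrodinger hv l f)]
  simp [add_smul]

theorem fourierL1_smul (c : ℂ) (u : Heis d → ℂ) (l : ℝ) (f : L2Euc d) :
    fourierL1 (c • u) l f = c • fourierL1 u l f := by
  rw [fourierL1, fourierL1, ← integral_smul]
  simp [smul_smul]

theorem coeFn_fourierL1 {u : Heis d → ℂ} (hu : StronglyMeasurable u) (hui : Integrable u)
    (l : ℝ) (f : L2Euc d) :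
    (∀ᵐ y, Integrable fun x => u x * schrodingerFun l x f y) ∧
      fourierL1 u l f =ᵐ[volume] fun y => ∫ x, u x * schrodingerFun l x f y := by
  refine coeFn_integral_Lp (k := fun x y => u x * schrodingerFun l x f y) ?_ (fun x => ?_)
    (integrable_smul_schrodinger hui l f)
  · exact (hu.comp_measurable measurable_fst).mul
      ((stronglyMeasurable_schrodingerFun (Lp.stronglyMeasurable f)).comp_measurable
        (g := fun z : Heis d × EuclideanSpace ℝ (Fin d) => ((l, z.1), z.2)) (by fun_prop))
  · filter_upwards [Lp.coeFn_smul (u x) (schrodinger l x f), coeFn_schrodinger l x f] with y h1 h2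
    rw [h1, Pi.smul_apply, h2, smul_eq_mul]

theorem stronglyMeasurable_fourierL1 {u : Heis d → ℂ} (hui : Integrable u) (f : L2Euc d) :
    StronglyMeasurable fun l => fourierL1 u l f := by
  obtain ⟨v, hv, huv⟩ := hui.1
  rw [fourierL1_congr huv]
  refine stronglyMeasurable_Lp_of_uncurry (k := fun l y => ∫ x, v x * schrodingerFun l x f y) ?_
    fun l => (coeFn_fourierL1 hv (hui.congr huv) l f).2
  have h : StronglyMeasurable fun z : (ℝ × EuclideanSpace ℝ (Fin d)) × Heis d =>
      v z.2 * schrodingerFun z.1.1 z.2 f z.1.2 :=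
    (hv.comp_measurable measurable_snd).mul
      ((stronglyMeasurable_schrodingerFun (Lp.stronglyMeasurable f)).comp_measurable
        (g := fun z : (ℝ × EuclideanSpace ℝ (Fin d)) × Heis d => ((z.1.1, z.2), z.1.2))
        (by fun_prop))
  exact h.integral_prod_right

/-- The partial Fourier transform of `u` in the central variable, at frequency `-l`. -/
def centralFourier (u : Heis d → ℂ) (l : ℝ) (p q : EuclideanSpace ℝ (Fin d)) : ℂ :=
  ∫ t, u (Heis.mk p q t) * Complex.exp (((2 * Real.pi * l * t : ℝ) : ℂ) * Complex.I)

open scoped FourierTransform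

theorem centralFourier_eq (u : Heis d → ℂ) (l : ℝ) (p q : EuclideanSpace ℝ (Fin d)) :
    centralFourier u l p q = 𝓕 (fun t => u (Heis.mk p q t)) (-l) := by
  rw [Real.fourier_eq', centralFourier]
  congr 1
  funext t
  rw [smul_eq_mul, mul_comm]
  congr 3
  simp
  ring

theorem stronglyMeasurable_centralFourier {u : Heis d → ℂ} (hu : StronglyMeasurable u) :
    StronglyMeasurable
      fun z : (ℝ × EuclideanSpace ℝ (Fin d)) × EuclideanSpace ℝ (Fin d) =>
        centralFourier u z.1.1 z.1.2 z.2 := by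
  have h : StronglyMeasurable
      fun z : ((ℝ × EuclideanSpace ℝ (Fin d)) × EuclideanSpace ℝ (Fin d)) × ℝ =>
        u (Heis.mk z.1.1.2 z.1.2 z.2) *
          Complex.exp (((2 * Real.pi * z.1.1.1 * z.2 : ℝ) : ℂ) * Complex.I) := by
    refine StronglyMeasurable.mul (hu.comp_measurable ?_) ?_
    · exact Heis.measurable_mk.comp
        (f := fun z : ((ℝ × EuclideanSpace ℝ (Fin d)) × EuclideanSpace ℝ (Fin d)) × ℝ =>
          (z.1.1.2, z.1.2, z.2)) (by fun_prop)
    · refine Measurable.stronglyMeasurable ?_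
      fun_prop
  exact h.integral_prod_right

/-- The character has modulus one, so the exceptional null set of `p` does not depend on `l`. -/
theorem ae_integrable_centralFourier {u : Heis d → ℂ} (hui : Integrable u) :
    ∀ᵐ p, ∀ l, Integrable (centralFourier u l p) := by
  filter_upwards [Heis.ae_integrable_slice hui] with p hp l
  refine Integrable.integral_prod_left (f := fun z : EuclideanSpace ℝ (Fin d) × ℝ =>
    u (Heis.mk p z.1 z.2) * Complex.exp (((2 * Real.pi * l * z.2 : ℝ) : ℂ) * Complex.I)) ?_
  refine hp.mul_bdd (c := 1) ?_ (ae_of_all _ fun z => ?_)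
  · refine Measurable.aestronglyMeasurable ?_
    fun_prop
  · rw [Complex.norm_exp_ofReal_mul_I]

/-- The integral kernel of `fourierL1 u l`. -/
theorem coeFn_fourierL1_eq_integral_fourier {u : Heis d → ℂ} (hu : StronglyMeasurable u)
    (hui : Integrable u) (l : ℝ) (f : L2Euc d) :
    fourierL1 u l f =ᵐ[volume]
      fun y => ∫ p, 𝓕 (centralFourier u l p) (l • y) * f (y - p) := by
  obtain ⟨h1, h2⟩ := coeFn_fourierL1 hu hui l f
  filter_upwards [h1, h2] with y hy1 hy2
  -- The `t`-integral is the central transform at `l`; the factor `e^{-2πil q·y}` then makes the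
  -- `q`-integral a Fourier transform evaluated at `l • y`.
  rw [hy2, Heis.integral_eq hy1]
  congr 1
  funext p
  rw [Real.fourier_eq', ← integral_mul_const]
  congr 1
  funext q
  rw [centralFourier, smul_eq_mul, ← integral_const_mul, ← integral_mul_const]
  congr 1
  funext t
  simp only [schrodingerFun, Heis.mk_p, Heis.mk_q, Heis.mk_t, inner_smul_right]
  have : -(2 * Real.pi * l * inner ℝ q y) = -2 * Real.pi * (l * inner ℝ q y) := by ring
  rw [this]
  ring

/-- This dilation is the source of the Plancherel weight `|l|ᵈ`: the kernel of the transform depends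
on `y` through `l • y`. -/
theorem lintegral_comp_smul_eq {g : EuclideanSpace ℝ (Fin d) → ℝ≥0∞} (hg : Measurable g) {l : ℝ}
    (hl : l ≠ 0) :
    (∫⁻ y, g (l • y)) * ENNReal.ofReal (|l| ^ d) = ∫⁻ y, g y := by
  have h := lintegral_map (μ := (volume : Measure (EuclideanSpace ℝ (Fin d)))) hg
    (measurable_const_smul l)
  rw [Measure.map_addHaar_smul _ hl, lintegral_smul_measure, finrank_euclideanSpace,
    Fintype.card_fin] at h
  rw [← h, smul_eq_mul, mul_comm, ← mul_assoc, ← ENNReal.ofReal_mul (by positivity), abs_inv,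
    abs_pow, mul_inv_cancel₀ (by positivity), ENNReal.ofReal_one, one_mul]

theorem stronglyMeasurable_fourier_centralFourier {u : Heis d → ℂ} (hu : StronglyMeasurable u)
    (l : ℝ) : StronglyMeasurable
      fun z : EuclideanSpace ℝ (Fin d) × EuclideanSpace ℝ (Fin d) =>
        𝓕 (centralFourier u l z.1) z.2 := by
  have h : StronglyMeasurable fun z : (EuclideanSpace ℝ (Fin d) × EuclideanSpace ℝ (Fin d)) ×
      EuclideanSpace ℝ (Fin d) =>
      Complex.exp (((-2 * Real.pi * inner ℝ z.2 z.1.2 : ℝ) : ℂ) * Complex.I) •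
        centralFourier u l z.1.1 z.2 := by
    refine StronglyMeasurable.fun_smul (𝕜 := ℂ) ?_ ((stronglyMeasurable_centralFourier hu).comp_measurable
      (g := fun z : (EuclideanSpace ℝ (Fin d) × EuclideanSpace ℝ (Fin d)) ×
        EuclideanSpace ℝ (Fin d) => ((l, z.1.1), z.2)) (by fun_prop))
    refine Measurable.stronglyMeasurable ?_
    fun_prop
  simp only [Real.fourier_eq']
  exact h.integral_prod_right

theorem memLp_two_of_lintegral_lt_top {X E : Type*} [MeasurableSpace X] {μ : Measure X}
    [NormedAddCommGroup E] {g : X → E} (hg : AEStronglyMeasurable g μ)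
    (h : ∫⁻ x, ‖g x‖ₑ ^ 2 ∂μ < ∞) : MemLp g 2 μ := by
  refine ⟨hg, ?_⟩
  rw [lintegral_enorm_sq_eq_eLpNorm] at h
  by_contra hc
  rw [not_lt, top_le_iff] at hc
  simp [hc] at h

/-- Distinct orthonormal vectors are at distance `√2`, so points of a countable dense set within
`1/2` of them are distinct. -/
instance : Countable (hsIndex d) := by
  have hD : Orthonormal ℂ ((↑) : hsIndex d → L2Euc d) := by
    have h := (hsBasis d).orthonormal
    have e : (⇑(hsBasis d) : hsIndex d → L2Euc d) = (↑) :=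
      (exists_hilbertBasis ℂ (L2Euc d)).choose_spec.choose_spec
    rwa [e] at h
  have hsep : ∀ i j : hsIndex d, i ≠ j → (1 : ℝ) ≤ dist (i : L2Euc d) j := by
    intro i j hij
    have h0 : inner ℂ (i : L2Euc d) (j : L2Euc d) = 0 := hD.2 hij
    have h1 := norm_sub_sq (𝕜 := ℂ) (i : L2Euc d) j
    rw [h0, hD.1 i, hD.1 j] at h1
    rw [dist_eq_norm]
    simp at h1
    nlinarith [norm_nonneg ((i : L2Euc d) - j)]
  obtain ⟨D, hDc, hDd⟩ := TopologicalSpace.exists_countable_dense (L2Euc d)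
  have hchoose : ∀ i : hsIndex d, ∃ y ∈ D, dist (i : L2Euc d) y < 1 / 2 :=
    fun i => hDd.exists_dist_lt _ (by norm_num)
  choose y hyD hy using hchoose
  have : Countable D := hDc
  refine Function.Injective.countable (f := fun i => (⟨y i, hyD i⟩ : D)) fun i j hij => ?_
  by_contra hne
  have e : y i = y j := congrArg Subtype.val hij
  have h1 := hsep i j hne
  have h2 := dist_triangle_right (i : L2Euc d) j (y i)
  have h3 := hy i
  have h4 := hy j
  rw [← e] at h4
  linarith

/-- The squared Hilbert-Schmidt norm is the squared `L²` norm of the kernel, by Parseval in the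
second variable. Rescaling `l • y` absorbs the weight, and Plancherel in `q` removes the remaining
transform. -/
theorem hsNormSq_fourierL1 {u : Heis d → ℂ} (hu : StronglyMeasurable u) (hui : Integrable u)
    {l : ℝ} (hl : l ≠ 0) (hfin : ∫⁻ p, ∫⁻ q, ‖centralFourier u l p q‖ₑ ^ 2 < ∞) :
    hsNormSq (fourierL1 u l) * ENNReal.ofReal (|l| ^ d) =
      ∫⁻ p, ∫⁻ q, ‖centralFourier u l p q‖ₑ ^ 2 := by
  set w : EuclideanSpace ℝ (Fin d) → EuclideanSpace ℝ (Fin d) → ℂ :=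
    fun p y => 𝓕 (centralFourier u l p) y with hw
  have hwm : StronglyMeasurable (Function.uncurry w) :=
    stronglyMeasurable_fourier_centralFourier hu l
  have hcm : StronglyMeasurable (Function.uncurry (centralFourier u l)) :=
    (stronglyMeasurable_centralFourier hu).comp_measurable
      (g := fun z : EuclideanSpace ℝ (Fin d) × EuclideanSpace ℝ (Fin d) => ((l, z.1), z.2))
      (by fun_prop)
  have hplan : ∀ᵐ p, ∫⁻ y, ‖w p y‖ₑ ^ 2 = ∫⁻ q, ‖centralFourier u l p q‖ₑ ^ 2 := by
    have hae := ae_lt_top (f := fun p => ∫⁻ q, ‖centralFourier u l p q‖ₑ ^ 2)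
      ((hcm.enorm.pow_const 2).lintegral_prod_right') hfin.ne
    filter_upwards [ae_integrable_centralFourier hui, hae] with p hp1 hp2
    exact lintegral_enorm_fourier_sq (hp1 l)
      (memLp_two_of_lintegral_lt_top (hp1 l).1 hp2)
  have hwl : Measurable fun z : EuclideanSpace ℝ (Fin d) × EuclideanSpace ℝ (Fin d) =>
      ‖w z.1 (l • z.2)‖ₑ ^ 2 :=
    (hwm.comp_measurable (g := fun z : EuclideanSpace ℝ (Fin d) × EuclideanSpace ℝ (Fin d) =>
      (z.1, l • z.2)) (by fun_prop)).enorm.pow_const 2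
  have hkey : (∫⁻ y, ∫⁻ p, ‖w p (l • y)‖ₑ ^ 2) * ENNReal.ofReal (|l| ^ d) =
      ∫⁻ p, ∫⁻ q, ‖centralFourier u l p q‖ₑ ^ 2 := by
    rw [lintegral_lintegral_swap (f := fun y p => ‖w p (l • y)‖ₑ ^ 2)
      (hwl.comp measurable_swap).aemeasurable, ← lintegral_mul_const _ hwl.lintegral_prod_right']
    refine lintegral_congr_ae ?_
    filter_upwards [hplan] with p hp
    rw [← hp]
    exact lintegral_comp_smul_eq (g := fun y => ‖w p y‖ₑ ^ 2)
      ((hwm.comp_measurable measurable_prodMk_left).enorm.pow_const 2) hl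
  have hpos : ENNReal.ofReal (|l| ^ d) ≠ 0 := by
    rw [Ne, ENNReal.ofReal_eq_zero, not_le]; positivity
  have hfiny : ∀ᵐ y, ∫⁻ p, ‖w p (l • y)‖ₑ ^ 2 < ∞ := by
    refine ae_lt_top (hwl.comp measurable_swap).lintegral_prod_right' fun htop => ?_
    rw [htop, ENNReal.top_mul hpos] at hkey
    exact hfin.ne hkey.symm
  rw [← hkey]
  congr 1
  simp only [hsNormSq, Lp.enorm_sq_eq_lintegral]
  rw [← lintegral_tsum fun i => ((Lp.stronglyMeasurable _).enorm.pow_const 2).aemeasurable]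
  refine lintegral_congr_ae ?_
  filter_upwards [ae_all_iff.2 fun i => coeFn_fourierL1_eq_integral_fourier hu hui l (hsBasis d i),
    hfiny] with y hy1 hy2
  have hmem : MemLp (fun p => w p (l • y)) 2 volume :=
    memLp_two_of_lintegral_lt_top (hwm.comp_measurable measurable_prodMk_right).aestronglyMeasurable
      hy2
  -- The kernel slice is conjugated because `inner` is conjugate-linear in its first argument.
  have hmem2 : MemLp (fun z => starRingEnd ℂ (w (y - z) (l • y))) 2 volume :=
    (hmem.comp_measurePreserving (Measure.measurePreserving_sub_left volume y)).star
  have hn : ‖hmem2.toLp _‖ₑ ^ 2 = ∫⁻ p, ‖w p (l • y)‖ₑ ^ 2 := by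
    rw [Lp.enorm_sq_eq_lintegral, ← lintegral_sub_left_eq_self (fun p => ‖w p (l • y)‖ₑ ^ 2) y]
    refine lintegral_congr_ae ?_
    filter_upwards [hmem2.coeFn_toLp] with z hz
    rw [hz, RCLike.enorm_conj]
  rw [← hn, ← HilbertBasis.tsum_enorm_inner_sq (hsBasis d)]
  refine tsum_congr fun i => ?_
  rw [hy1 i, L2.inner_def]
  congr 2
  rw [← integral_sub_left_eq_self (fun p => 𝓕 (centralFourier u l p) (l • y) *
    hsBasis d i (y - p)) volume y]
  refine integral_congr_ae ?_
  filter_upwards [hmem2.coeFn_toLp] with z hz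
  rw [hz]
  simp [hw, mul_comm]

/-- Plancherel's theorem on the Heisenberg group, for `u ∈ L¹ ∩ L²`. -/
theorem lintegral_hsNormSq_fourierL1 {u : Heis d → ℂ} (hui : Integrable u) (hu2 : MemLp u 2) :
    ∫⁻ l : ℝ, hsNormSq (fourierL1 u l) * ENNReal.ofReal (|l| ^ d) = ∫⁻ x, ‖u x‖ₑ ^ 2 := by
  obtain ⟨v, hv, huv⟩ := hui.1
  rw [fourierL1_congr huv, lintegral_congr_ae (g := fun x => ‖v x‖ₑ ^ 2)
    (by filter_upwards [huv] with x hx; rw [hx])]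
  replace hui := hui.congr huv
  replace hu2 := (memLp_congr_ae huv).1 hu2
  clear huv u
  have hvfin : ∫⁻ x, ‖v x‖ₑ ^ 2 < ∞ := by
    rw [lintegral_enorm_sq_eq_eLpNorm]
    exact ENNReal.pow_lt_top hu2.2
  have hvm : Measurable fun x => ‖v x‖ₑ ^ 2 := hv.enorm.pow_const 2
  have hcm := stronglyMeasurable_centralFourier hv
  -- Plancherel in the central variable for almost every `(p, q)`; the reflection of `l` accounts
  -- for the frequency `-l` in `centralFourier_eq`. Finiteness of the total then supplies, for
  -- almost every `l`, the hypothesis of `hsNormSq_fourierL1`.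
  have hmain : ∫⁻ l : ℝ, ∫⁻ p, ∫⁻ q, ‖centralFourier v l p q‖ₑ ^ 2 = ∫⁻ x, ‖v x‖ₑ ^ 2 := by
    rw [lintegral_lintegral_swap (f := fun l p => ∫⁻ q, ‖centralFourier v l p q‖ₑ ^ 2)
      (hcm.enorm.pow_const 2).lintegral_prod_right'.aemeasurable]
    have hvfin' := hvfin
    rw [Heis.lintegral_eq hvm] at hvfin' ⊢
    have hm2 : Measurable fun z : EuclideanSpace ℝ (Fin d) × EuclideanSpace ℝ (Fin d) =>
        ∫⁻ t, ‖v (Heis.mk z.1 z.2 t)‖ₑ ^ 2 :=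
      ((hvm.comp Heis.measurable_mk).comp (f := fun z : (EuclideanSpace ℝ (Fin d) ×
        EuclideanSpace ℝ (Fin d)) × ℝ => (z.1.1, z.1.2, z.2))
        (by fun_prop)).lintegral_prod_right'
    have hae1 : ∀ᵐ p, ∫⁻ q, ∫⁻ t, ‖v (Heis.mk p q t)‖ₑ ^ 2 < ∞ :=
      ae_lt_top hm2.lintegral_prod_right' hvfin'.ne
    refine lintegral_congr_ae ?_
    filter_upwards [hae1, Heis.ae_integrable_slice hui] with p hp1 hp2
    rw [lintegral_lintegral_swap (f := fun l q => ‖centralFourier v l p q‖ₑ ^ 2)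
      ((hcm.comp_measurable (g := fun z : ℝ × EuclideanSpace ℝ (Fin d) => ((z.1, p), z.2))
        (by fun_prop)).enorm.pow_const 2).aemeasurable]
    have hae2 : ∀ᵐ q, ∫⁻ t, ‖v (Heis.mk p q t)‖ₑ ^ 2 < ∞ :=
      ae_lt_top (hm2.comp measurable_prodMk_left) hp1.ne
    refine lintegral_congr_ae ?_
    filter_upwards [hae2, hp2.prod_right_ae] with q hq1 hq2
    rw [← lintegral_enorm_fourier_sq hq2 (memLp_two_of_lintegral_lt_top hq2.1 hq1),
      ← lintegral_neg_eq_self (fun l => ‖𝓕 (fun t => v (Heis.mk p q t)) l‖ₑ ^ 2)]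
    simp only [centralFourier_eq]
  rw [← hmain]
  have hae : ∀ᵐ l : ℝ, ∫⁻ p, ∫⁻ q, ‖centralFourier v l p q‖ₑ ^ 2 < ∞ := by
    refine ae_lt_top ?_ (by rw [hmain]; exact hvfin.ne)
    exact (hcm.enorm.pow_const 2).lintegral_prod_right'.lintegral_prod_right'
  have h0 : ∀ᵐ l : ℝ, l ≠ 0 := by simp [ae_iff, measure_singleton]
  refine lintegral_congr_ae ?_
  filter_upwards [hae, h0] with l hl1 hl2
  exact hsNormSq_fourierL1 hv hui hl2 hl1

end
end

/-! ### Extension of the Fourier transform to `L²` -/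

noncomputable section

section

/-- Cauchy-Schwarz between the coefficients of `f` and the norms `‖g i‖` gives absolute convergence
and a bound: square summable columns define a bounded operator. -/
theorem HilbertBasis.exists_clm_hasSum {ι H K : Type*} [NormedAddCommGroup H]
    [InnerProductSpace ℂ H] [NormedAddCommGroup K] [NormedSpace ℂ K] [CompleteSpace K]
    (b : HilbertBasis ι ℂ H) {g : ι → K} (hg : Summable fun i => ‖g i‖ ^ 2) :
    ∃ T : H →L[ℂ] K, ∀ f, HasSum (fun i => (inner ℂ (b i) f : ℂ) • g i) (T f) := by
  have hb : ∀ f : H, HasSum (fun i => ‖(inner ℂ (b i) f : ℂ)‖ ^ 2) (‖f‖ ^ 2) := by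
    intro f
    have h := Complex.hasSum_re (b.hasSum_inner_mul_inner f f)
    convert h using 1
    · funext i
      rw [← inner_conj_symm f (b i), mul_comm, Complex.mul_conj, Complex.normSq_eq_norm_sq]
      simp only [Complex.ofReal_re]
    · exact (inner_self_eq_norm_sq (𝕜 := ℂ) f).symm
  have hn : ∀ f : H, Summable (fun i => ‖(inner ℂ (b i) f : ℂ)‖ * ‖g i‖) ∧
      ∑' i, ‖(inner ℂ (b i) f : ℂ)‖ * ‖g i‖ ≤ ‖f‖ * √(∑' i, ‖g i‖ ^ 2) := by
    intro f
    have h := Real.summable_and_inner_le_Lp_mul_Lq_tsum_of_nonneg (p := 2) (q := 2)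
      Real.HolderConjugate.two_two
      (f := fun i => ‖(inner ℂ (b i) f : ℂ)‖) (g := fun i => ‖g i‖)
      (fun i => norm_nonneg _) (fun i => norm_nonneg _) (by simpa using (hb f).summable)
      (by simpa using hg)
    refine ⟨h.1, h.2.trans_eq ?_⟩
    simp only [Real.rpow_ofNat, (hb f).tsum_eq, ← Real.sqrt_eq_rpow]
    rw [Real.sqrt_sq (norm_nonneg _)]
  have hs : ∀ f : H, Summable fun i => (inner ℂ (b i) f : ℂ) • g i := fun f =>
    Summable.of_norm (by simpa only [norm_smul] using (hn f).1)
  refine ⟨LinearMap.mkContinuous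
    { toFun := fun f => ∑' i, (inner ℂ (b i) f : ℂ) • g i
      map_add' := fun f f' => ?_
      map_smul' := fun c f => ?_ } (√(∑' i, ‖g i‖ ^ 2)) fun f => ?_, fun f => (hs f).hasSum⟩
  · rw [← (hs f).tsum_add (hs f')]
    simp only [inner_add_right, add_smul]
  · rw [RingHom.id_apply, ← tsum_const_smul'']
    simp only [inner_smul_right, smul_smul]
  · rw [mul_comm]
    refine le_trans (norm_tsum_le_tsum_norm ?_) ?_
    · simpa only [norm_smul] using (hn f).1
    · simpa only [norm_smul] using (hn f).2

variable {d : ℕ}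

instance hsIndex.measurableSpace : MeasurableSpace (hsIndex d) := ⊤

instance hsIndex.discreteMeasurableSpace : DiscreteMeasurableSpace (hsIndex d) :=
  ⟨fun _ => trivial⟩

variable (d) in
/-- The Plancherel measure `|l|ᵈ dl`. -/
def plancherelMeasure : Measure ℝ := volume.withDensity fun l => ENNReal.ofReal (|l| ^ d)

variable (d) in
theorem measurable_plancherelDensity : Measurable fun l : ℝ => ENNReal.ofReal (|l| ^ d) := by
  fun_prop

theorem plancherelMeasure_absolutelyContinuous : plancherelMeasure d ≪ volume :=
  withDensity_absolutelyContinuous _ _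

theorem absolutelyContinuous_plancherelMeasure : volume ≪ plancherelMeasure d := by
  refine withDensity_absolutelyContinuous' (measurable_plancherelDensity d).aemeasurable ?_
  have h0 : ∀ᵐ l : ℝ, l ≠ 0 := by simp [ae_iff, measure_singleton]
  filter_upwards [h0] with l hl
  rw [Ne, ENNReal.ofReal_eq_zero, not_le]
  positivity

instance : SigmaFinite (plancherelMeasure d) :=
  SigmaFinite.withDensity_ofReal _

theorem lintegral_plancherelMeasure (g : ℝ → ℝ≥0∞) :
    ∫⁻ l, g l ∂(plancherelMeasure d) = ∫⁻ l, g l * ENNReal.ofReal (|l| ^ d) := by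
  rw [plancherelMeasure, lintegral_withDensity_eq_lintegral_mul_non_measurable _
    (measurable_plancherelDensity d) (ae_of_all _ fun _ => ENNReal.ofReal_lt_top)]
  simp only [Pi.mul_apply, mul_comm]

variable (d) in
/-- The measure on `ℝ × hsIndex d` for which `L²(ℝ × hsIndex d, L²(ℝᵈ))` is identified with
`L²(ℝ, HS(L²(ℝᵈ)), |l|ᵈ dl)`. -/
def hsMeasure : Measure (ℝ × hsIndex d) := (plancherelMeasure d).prod Measure.count

/-- The columns of a family of operators with respect to the Hilbert basis `hsBasis d`. -/
def hsColumns (T : ℝ → L2Euc d → L2Euc d) (z : ℝ × hsIndex d) : L2Euc d := T z.1 (hsBasis d z.2)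

theorem ae_hsMeasure_of_forall_ae {P : ℝ × hsIndex d → Prop}
    (h : ∀ i, ∀ᵐ l ∂(plancherelMeasure d), P (l, i)) : ∀ᵐ z ∂(hsMeasure d), P z := by
  rw [ae_iff]
  have hsub : {z | ¬ P z} ⊆ ⋃ i : hsIndex d, {l | ¬ P (l, i)} ×ˢ {i} := by
    rintro ⟨l, i⟩ hz
    exact mem_iUnion.2 ⟨i, hz, rfl⟩
  refine measure_mono_null hsub (measure_iUnion_null fun i => ?_)
  rw [hsMeasure, Measure.prod_prod, ae_iff.1 (h i), zero_mul]

theorem aestronglyMeasurable_hsMeasure {G : ℝ × hsIndex d → L2Euc d}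
    (h : ∀ i, AEStronglyMeasurable (fun l => G (l, i)) (plancherelMeasure d)) :
    AEStronglyMeasurable G (hsMeasure d) := by
  refine ⟨fun z => (h z.2).mk _ z.1, ?_, ?_⟩
  · let : MeasurableSpace (L2Euc d) := borel _
    have : BorelSpace (L2Euc d) := ⟨rfl⟩
    exact (measurable_from_prod_countable_left fun i =>
      (h i).stronglyMeasurable_mk.measurable).stronglyMeasurable
  · exact ae_hsMeasure_of_forall_ae fun i => (h i).ae_eq_mk

theorem lintegral_hsColumns {T : ℝ → L2Euc d → L2Euc d}
    (hT : AEStronglyMeasurable (hsColumns T) (hsMeasure d)) :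
    ∫⁻ z, ‖hsColumns T z‖ₑ ^ 2 ∂(hsMeasure d) =
      ∫⁻ l : ℝ, hsNormSq (T l) * ENNReal.ofReal (|l| ^ d) := by
  rw [hsMeasure, lintegral_prod _ (hT.enorm.pow_const 2), ← lintegral_plancherelMeasure]
  refine lintegral_congr fun l => ?_
  rw [lintegral_count]
  rfl

theorem aestronglyMeasurable_hsColumns {T : ℝ → L2Euc d → L2Euc d}
    (hT : ∀ f : L2Euc d, AEStronglyMeasurable (fun l => T l f) volume) :
    AEStronglyMeasurable (hsColumns T) (hsMeasure d) :=
  aestronglyMeasurable_hsMeasure fun i =>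
    (hT (hsBasis d i)).mono_ac plancherelMeasure_absolutelyContinuous

theorem memLp_hsColumns_fourierL1 {u : Heis d → ℂ} (hu : Integrable u) (hu2 : MemLp u 2) :
    MemLp (hsColumns (fourierL1 u)) 2 (hsMeasure d) := by
  have hm := aestronglyMeasurable_hsColumns (T := fourierL1 u)
    fun f => (stronglyMeasurable_fourierL1 hu f).aestronglyMeasurable
  refine memLp_two_of_lintegral_lt_top hm ?_
  rw [lintegral_hsColumns hm, lintegral_hsNormSq_fourierL1 hu hu2, lintegral_enorm_sq_eq_eLpNorm]
  exact ENNReal.pow_lt_top hu2.2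

variable (d) in
/-- The subspace `L¹ ∩ L²` of `L²(ℍᵈ)`. -/
def integrableL2 : Submodule ℂ (L2Heis d) where
  carrier := {u | Integrable u volume}
  add_mem' {u v} hu hv := (Integrable.add (f := u) (g := v) hu hv).congr (Lp.coeFn_add u v).symm
  zero_mem' := (integrable_zero (Heis d) ℂ volume).congr (Lp.coeFn_zero ℂ 2 volume).symm
  smul_mem' c u hu := (Integrable.smul (f := u) c hu).congr (Lp.coeFn_smul c u).symm

/-- Square integrable simple functions are supported on sets of finite measure, hence integrable. -/
theorem dense_integrableL2 : Dense (integrableL2 d : Set (L2Heis d)) := by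
  refine (Lp.simpleFunc.dense (E := ℂ) (μ := (volume : Measure (Heis d))) (p := 2)
    ENNReal.ofNat_ne_top).mono fun u hu => ?_
  have h := (SimpleFunc.memLp_iff_integrable two_ne_zero ENNReal.ofNat_ne_top).1
    (Lp.simpleFunc.memLp (⟨u, hu⟩ : Lp.simpleFunc ℂ 2 (volume : Measure (Heis d))))
  exact h.congr (Lp.simpleFunc.toSimpleFunc_eq_toFun _)

variable (d) in
/-- The Fourier transform on `L¹ ∩ L²` as a linear isometry into the space of square integrable
families of columns. -/
def fourierIsometry : integrableL2 d →ₗᵢ[ℂ] Lp (L2Euc d) 2 (hsMeasure d) where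
  toFun u := (memLp_hsColumns_fourierL1 u.2 (Lp.memLp u.1)).toLp _
  map_add' u v := by
    rw [← MemLp.toLp_add]
    refine MemLp.toLp_congr _ _ (ae_of_all _ fun z => ?_)
    rw [Pi.add_apply]
    simp only [hsColumns]
    rw [← fourierL1_add u.2 v.2, fourierL1_congr (Lp.coeFn_add u.1 v.1).symm]
    rfl
  map_smul' c u := by
    rw [RingHom.id_apply, ← MemLp.toLp_const_smul]
    refine MemLp.toLp_congr _ _ (ae_of_all _ fun z => ?_)
    rw [Pi.smul_apply]
    simp only [hsColumns]
    rw [← fourierL1_smul, fourierL1_congr (Lp.coeFn_smul c u.1).symm]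
    rfl
  norm_map' u := by
    have hm := memLp_hsColumns_fourierL1 u.2 (Lp.memLp u.1)
    have h1 := Lp.enorm_sq_eq_lintegral (hm.toLp _)
    rw [lintegral_congr_ae (g := fun z => ‖hsColumns (fourierL1 (u.1 : Heis d → ℂ)) z‖ₑ ^ 2)
      (by filter_upwards [hm.coeFn_toLp] with z hz; rw [hz]), lintegral_hsColumns hm.1,
      lintegral_hsNormSq_fourierL1 u.2 (Lp.memLp u.1), ← Lp.enorm_sq_eq_lintegral] at h1
    have h2 := ENNReal.pow_right_strictMono two_ne_zero |>.injective h1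
    rw [Submodule.coe_norm, ← toReal_enorm (u : L2Heis d), ← h2, toReal_enorm]
    rfl

theorem coeFn_fourierIsometry (u : integrableL2 d) :
    fourierIsometry d u =ᵐ[hsMeasure d] hsColumns (fourierL1 (u : L2Heis d)) :=
  (memLp_hsColumns_fourierL1 u.2 (Lp.memLp u.1)).coeFn_toLp

theorem IsFourierTransform.aestronglyMeasurable_hsColumns {φ : L2Heis d}
    {T : ℝ → L2Euc d →L[ℂ] L2Euc d} (h : IsFourierTransform φ T) :
    AEStronglyMeasurable (hsColumns fun l f => T l f) (hsMeasure d) :=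
  _root_.aestronglyMeasurable_hsColumns (T := fun l f => T l f) h.1

theorem lintegral_fourierIsometry_sub {T : ℝ → L2Euc d →L[ℂ] L2Euc d}
    (hT : AEStronglyMeasurable (hsColumns fun l f => T l f) (hsMeasure d)) (u : integrableL2 d) :
    ∫⁻ z, ‖fourierIsometry d u z - hsColumns (fun l f => T l f) z‖ₑ ^ 2 ∂(hsMeasure d) =
      ∫⁻ l : ℝ, hsNormSq (fun f => fourierL1 (u : L2Heis d) l f - T l f) *
        ENNReal.ofReal (|l| ^ d) := by
  rw [← lintegral_hsColumns (T := fun l f => fourierL1 (u : L2Heis d) l f - T l f)]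
  · refine lintegral_congr_ae ?_
    filter_upwards [coeFn_fourierIsometry u] with z hz
    rw [hz]
    rfl
  · exact (memLp_hsColumns_fourierL1 u.2 (Lp.memLp u.1)).1.sub hT

/-- The columns of `T` differ from some `fourierIsometry d (u n)` by a function of squared norm
below one. -/
theorem IsFourierTransform.memLp {φ : L2Heis d} {T : ℝ → L2Euc d →L[ℂ] L2Euc d}
    (h : IsFourierTransform φ T) : MemLp (hsColumns fun l f => T l f) 2 (hsMeasure d) := by
  obtain ⟨u, hu, -, hlim⟩ := h.2
  obtain ⟨n, hn⟩ := (hlim.eventually (gt_mem_nhds (zero_lt_one (α := ℝ≥0∞)))).exists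
  rw [← lintegral_fourierIsometry_sub h.aestronglyMeasurable_hsColumns ⟨u n, hu n⟩] at hn
  have h1 := memLp_two_of_lintegral_lt_top
    ((Lp.aestronglyMeasurable _).sub h.aestronglyMeasurable_hsColumns)
    (hn.trans ENNReal.one_lt_top)
  refine ((Lp.memLp (fourierIsometry d ⟨u n, hu n⟩)).sub h1).ae_eq (ae_of_all _ fun z => ?_)
  simp

theorem IsFourierTransform.exists_tendsto {φ : L2Heis d} {T : ℝ → L2Euc d →L[ℂ] L2Euc d}
    (h : IsFourierTransform φ T) : ∃ u : ℕ → integrableL2 d,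
      Tendsto (fun n => (u n : L2Heis d)) atTop (𝓝 φ) ∧
      Tendsto (fun n => fourierIsometry d (u n)) atTop (𝓝 (h.memLp.toLp _)) := by
  obtain ⟨u, hu, hφ, hlim⟩ := h.2
  refine ⟨fun n => ⟨u n, hu n⟩, hφ, ?_⟩
  rw [tendsto_iff_edist_tendsto_0]
  have h1 : ∀ n, edist (fourierIsometry d ⟨u n, hu n⟩) (h.memLp.toLp _) =
      (∫⁻ l : ℝ, hsNormSq (fun f => fourierL1 (u n) l f - T l f) *
        ENNReal.ofReal (|l| ^ d)) ^ (2⁻¹ : ℝ) := by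
    intro n
    rw [← lintegral_fourierIsometry_sub h.aestronglyMeasurable_hsColumns ⟨u n, hu n⟩,
      lintegral_enorm_sq_eq_eLpNorm, Lp.edist_def, ← ENNReal.rpow_natCast, ← ENNReal.rpow_mul]
    norm_num
    exact eLpNorm_congr_ae (ae_eq_rfl.sub h.memLp.coeFn_toLp)
  simp only [h1]
  simpa using hlim.ennrpow_const (2⁻¹ : ℝ)

/-- The isometry preserves inner products along the approximating sequences, and both sides are
limits. Later computations may therefore use any representative of the transform. -/
theorem IsFourierTransform.inner_toLp {φ ψ : L2Heis d} {T S : ℝ → L2Euc d →L[ℂ] L2Euc d}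
    (hT : IsFourierTransform φ T) (hS : IsFourierTransform ψ S) :
    inner ℂ (hT.memLp.toLp _) (hS.memLp.toLp _) = inner ℂ φ ψ := by
  obtain ⟨u, hu, huT⟩ := hT.exists_tendsto
  obtain ⟨v, hv, hvS⟩ := hS.exists_tendsto
  refine tendsto_nhds_unique (huT.inner hvS) ?_
  simp only [LinearIsometry.inner_map_map]
  exact hu.inner hv

/-- The isometric images of an approximating sequence converge to some `G` by completeness. For
almost every `l` the columns `G (l, i)` are square summable, so they come from an operator. -/
theorem exists_isFourierTransform (φ : L2Heis d) :
    ∃ T : ℝ → L2Euc d →L[ℂ] L2Euc d, IsFourierTransform φ T := by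
  obtain ⟨u, hu, huφ⟩ := mem_closure_iff_seq_limit.1 (dense_integrableL2 φ)
  set v : ℕ → integrableL2 d := fun n => ⟨u n, hu n⟩
  have hc : CauchySeq fun n => fourierIsometry d (v n) := by
    refine ((fourierIsometry d).isometry.uniformContinuous).comp_cauchySeq ?_
    refine isUniformEmbedding_subtype_val.isUniformInducing.cauchy_map_iff.1 ?_
    rw [map_map]
    exact huφ.cauchySeq
  obtain ⟨G, hG⟩ := cauchySeq_tendsto_of_complete hc
  have hGsq : ∫⁻ z, ‖G z‖ₑ ^ 2 ∂((plancherelMeasure d).prod Measure.count) < ∞ := by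
    refine (Lp.enorm_sq_eq_lintegral G).symm.trans_lt ?_
    exact ENNReal.pow_lt_top enorm_lt_top
  have hGm : StronglyMeasurable G := Lp.stronglyMeasurable G
  have hsum : ∀ᵐ l : ℝ, Summable fun i : hsIndex d => ‖G (l, i)‖ ^ 2 := by
    rw [lintegral_prod _ (hGm.enorm.pow_const 2).aemeasurable] at hGsq
    refine absolutelyContinuous_plancherelMeasure (d := d) ?_
    filter_upwards [ae_lt_top (hGm.enorm.pow_const 2).lintegral_prod_right' hGsq.ne] with l hl
    rw [lintegral_count] at hl
    have h1 := ENNReal.summable_toReal hl.ne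
    simpa using h1
  classical
  -- On the null set where the columns are not square summable, `T l` is arbitrary.
  choose! T hT using fun l (hl : Summable fun i : hsIndex d => ‖G (l, i)‖ ^ 2) =>
    (hsBasis d).exists_clm_hasSum hl
  have hTe : ∀ᵐ l : ℝ, ∀ i, T l (hsBasis d i) = G (l, i) := by
    filter_upwards [hsum] with l hl i
    refine (hT l hl (hsBasis d i)).unique ?_
    have h := hasSum_single (f := fun j => (inner ℂ (hsBasis d j) (hsBasis d i) : ℂ) • G (l, j)) i
      fun j hj => by
        rw [(hsBasis d).orthonormal.2 hj, zero_smul]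
    rwa [inner_self_eq_norm_sq_to_K, (hsBasis d).orthonormal.1 i, RCLike.ofReal_one, one_pow,
      one_smul] at h
  have hTm : ∀ f, AEStronglyMeasurable (fun l => T l f) volume := by
    intro f
    -- Countability of the basis makes the filter of finite subsets countably generated, so almost
    -- everywhere limits along it stay measurable.
    refine aestronglyMeasurable_of_tendsto_ae (u := (atTop : Filter (Finset (hsIndex d))))
      (f := fun s l => ∑ i ∈ s, (inner ℂ (hsBasis d i) f : ℂ) • G (l, i)) (fun s => ?_) ?_
    · refine (Finset.stronglyMeasurable_fun_sum s fun i _ => ?_).aestronglyMeasurable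
      exact StronglyMeasurable.const_smul
        (hGm.comp_measurable measurable_prodMk_right :
          StronglyMeasurable fun l => G (l, i)) (inner ℂ (hsBasis d i) f : ℂ)
    · filter_upwards [hsum] with l hl
      exact hT l hl f
  have hTc : AEStronglyMeasurable (hsColumns fun l f => T l f) (hsMeasure d) :=
    aestronglyMeasurable_hsColumns (T := fun l f => T l f) hTm
  have hTG : hsColumns (fun l f => T l f) =ᵐ[hsMeasure d] G :=
    ae_hsMeasure_of_forall_ae fun i => plancherelMeasure_absolutelyContinuous (d := d)
      (by filter_upwards [hTe] with l hl using hl i)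
  refine ⟨T, hTm, u, hu, huφ, ?_⟩
  have h1 : ∀ n, ∫⁻ l : ℝ, hsNormSq (fun f => fourierL1 (u n) l f - T l f) *
        ENNReal.ofReal (|l| ^ d) = edist (fourierIsometry d (v n)) G ^ 2 := by
    intro n
    rw [← lintegral_fourierIsometry_sub hTc (v n), lintegral_enorm_sq_eq_eLpNorm, Lp.edist_def]
    congr 1
    exact eLpNorm_congr_ae (ae_eq_rfl.sub hTG)
  simp only [h1]
  have h2 := (tendsto_iff_edist_tendsto_0.1 hG)
  simpa using! ENNReal.Tendsto.pow (n := 2) h2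

theorem isFourierTransform_heisFourier (φ : L2Heis d) : IsFourierTransform φ (heisFourier φ) := by
  have h := exists_isFourierTransform φ
  rw [heisFourier, dif_pos h]
  exact h.choose_spec

end
end

/-! ### Central translations, Parseval and the bracket -/

noncomputable section

section

variable {d : ℕ}

/-- The character `e^{2πils}`. -/
def centralChar (s l : ℝ) : ℂ := Complex.exp (((2 * Real.pi * l * s : ℝ) : ℂ) * Complex.I)

theorem norm_centralChar (s l : ℝ) : ‖centralChar s l‖ = 1 := Complex.norm_exp_ofReal_mul_I _

theorem continuous_centralChar (s : ℝ) : Continuous (centralChar s) := by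
  unfold centralChar
  fun_prop

/-- This periodicity lets the character of an integral central translation leave the sum over `j` in
the bracket. -/
theorem centralChar_add_int (k : ℤ) (l : ℝ) (j : ℤ) :
    centralChar k (l + j) = centralChar k l := by
  rw [centralChar, centralChar, Complex.exp_eq_exp_iff_exists_int]
  exact ⟨j * k, by push_cast; ring⟩

theorem leftTranslate_mul (g h : Heis d) (ψ : L2Heis d) :
    leftTranslate (g * h) ψ = leftTranslate g (leftTranslate h ψ) := by
  rw [leftTranslate, leftTranslate, leftTranslate, ← Lp.compMeasurePreserving_comp_apply]
  congr 2
  funext x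
  simp [mul_assoc]

theorem leftTranslate_one (ψ : L2Heis d) : leftTranslate 1 ψ = ψ := by
  have h := Lp.compMeasurePreserving_id_apply ψ
  conv_rhs => rw [← h]
  rw [leftTranslate]
  congr 2
  funext x
  simp

/-- Left translation as a linear isometry. -/
def leftTranslateIsometry (g : Heis d) : L2Heis d →ₗᵢ[ℂ] L2Heis d :=
  Lp.compMeasurePreservingₗᵢ ℂ (fun x => g⁻¹ * x) (Heis.measurePreserving_mul_left g⁻¹)

theorem leftTranslateIsometry_apply (g : Heis d) (ψ : L2Heis d) :
    leftTranslateIsometry g ψ = leftTranslate g ψ := rfl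

theorem coeFn_leftTranslate (g : Heis d) (ψ : L2Heis d) :
    leftTranslate g ψ =ᵐ[volume] fun x => ψ (g⁻¹ * x) :=
  Lp.coeFn_compMeasurePreserving ψ (Heis.measurePreserving_mul_left g⁻¹)

theorem Heis.measurableEmbedding_mul_left (g : Heis d) :
    MeasurableEmbedding fun x : Heis d => g * x :=
  (MeasurableEquiv.mk (Equiv.mulLeft g) (Heis.measurePreserving_mul_left g).measurable
    (Heis.measurePreserving_mul_left g⁻¹).measurable).measurableEmbedding

theorem schrodinger_central_mul (s l : ℝ) (x : Heis d) (f : L2Euc d) :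
    schrodinger l (Heis.mk 0 0 s * x) f = centralChar s l • schrodinger l x f := by
  rw [schrodinger, schrodinger, ← MemLp.toLp_const_smul]
  refine MemLp.toLp_congr _ _ (ae_of_all _ fun y => ?_)
  simp only [schrodingerFun, centralChar, Heis.mul_p, Heis.mul_q, Heis.mul_t, Heis.mk_p, Heis.mk_q,
    Heis.mk_t, inner_zero_left, zero_add, add_zero, Pi.smul_apply, smul_eq_mul]
  rw [mul_add, Complex.ofReal_add, add_mul, Complex.exp_add]
  ring

theorem fourierL1_leftTranslate_central (u : L2Heis d) (s l : ℝ) (f : L2Euc d) :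
    fourierL1 (leftTranslate (Heis.mk 0 0 s) u) l f = centralChar s l • fourierL1 u l f := by
  rw [fourierL1_congr (coeFn_leftTranslate _ u), fourierL1,
    ← (Heis.measurePreserving_mul_left (Heis.mk 0 0 s)).integral_comp
      (Heis.measurableEmbedding_mul_left _), fourierL1, ← integral_smul]
  congr 1
  funext x
  rw [schrodinger_central_mul, inv_mul_cancel_left, smul_comm]

theorem hsNormSq_smul (c : ℂ) (S : L2Euc d → L2Euc d) :
    hsNormSq (fun f => c • S f) = ‖c‖ₑ ^ 2 * hsNormSq S := by
  simp only [hsNormSq, enorm_smul, mul_pow]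
  exact ENNReal.tsum_mul_left

/-- The center acts through `Π_l` by scalars of modulus one, which leave the Hilbert-Schmidt
distances in the limit unchanged. -/
theorem IsFourierTransform.leftTranslate_central {φ : L2Heis d} {T : ℝ → L2Euc d →L[ℂ] L2Euc d}
    (h : IsFourierTransform φ T) (s : ℝ) :
    IsFourierTransform (leftTranslate (Heis.mk 0 0 s) φ) fun l => centralChar s l • T l := by
  obtain ⟨hm, u, hu, huφ, hlim⟩ := h
  refine ⟨fun f => (continuous_centralChar s).aestronglyMeasurable.smul (hm f),
    fun n => leftTranslate (Heis.mk 0 0 s) (u n), fun n => ?_, ?_, ?_⟩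
  · exact (((Heis.measurePreserving_mul_left (Heis.mk 0 0 s)⁻¹).integrable_comp_emb
      (Heis.measurableEmbedding_mul_left _)).2 (hu n)).congr (coeFn_leftTranslate _ _).symm
  · exact ((leftTranslateIsometry (Heis.mk 0 0 s)).continuous.tendsto φ).comp huφ
  · convert hlim using 4 with n l
    rw [show (fun f => fourierL1 (leftTranslate (Heis.mk 0 0 s) (u n)) l f -
      (centralChar s l • T l) f) = fun f => centralChar s l • (fourierL1 (u n) l f - T l f) by
        funext f
        rw [fourierL1_leftTranslate_central, smul_sub]
        rfl, hsNormSq_smul]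
    rw [← ofReal_norm, norm_centralChar]
    simp

theorem hsInner_smul_left (c : ℂ) (S T : L2Euc d →L[ℂ] L2Euc d) :
    hsInner (c • S) T = c * hsInner S T := by
  simp only [hsInner]
  rw [← tsum_mul_left]
  congr 1
  funext i
  rw [_root_.smul_apply, inner_smul_right]

theorem hsInner_self (S : L2Euc d →L[ℂ] L2Euc d) :
    hsInner S S = ((hsNormSq fun f => S f).toReal : ℂ) := by
  rw [hsInner, hsNormSq, ENNReal.tsum_toReal_eq fun i => by simp, Complex.ofReal_tsum]
  congr 1
  funext i
  rw [inner_self_eq_norm_sq_to_K]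
  simp

theorem integral_count_eq_tsum {ι : Type*} [MeasurableSpace ι] [DiscreteMeasurableSpace ι]
    {f : ι → ℂ} (hf : Integrable f Measure.count) : ∫ i, f i ∂Measure.count = ∑' i, f i := by
  rw [Measure.count] at hf ⊢
  rw [integral_sum_measure hf]
  simp

/-- Parseval's identity for the Fourier transform on the Heisenberg group. -/
theorem IsFourierTransform.integral_hsInner {φ ψ : L2Heis d} {T S : ℝ → L2Euc d →L[ℂ] L2Euc d}
    (hT : IsFourierTransform φ T) (hS : IsFourierTransform ψ S) :
    Integrable (fun l : ℝ => hsInner (T l) (S l) * ((|l| ^ d : ℝ) : ℂ)) ∧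
      ∫ l : ℝ, hsInner (T l) (S l) * ((|l| ^ d : ℝ) : ℂ) = inner ℂ ψ φ := by
  have h1 : Integrable (fun z : ℝ × hsIndex d =>
      (inner ℂ (S z.1 (hsBasis d z.2)) (T z.1 (hsBasis d z.2)) : ℂ)) (hsMeasure d) := by
    refine (L2.integrable_inner (𝕜 := ℂ) (hS.memLp.toLp _) (hT.memLp.toLp _)).congr ?_
    filter_upwards [hS.memLp.coeFn_toLp, hT.memLp.coeFn_toLp] with z hz1 hz2
    rw [hz1, hz2]
    rfl
  have h2 : ∫ z : ℝ × hsIndex d,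
      (inner ℂ (S z.1 (hsBasis d z.2)) (T z.1 (hsBasis d z.2)) : ℂ) ∂(hsMeasure d) =
      inner ℂ ψ φ := by
    rw [← hS.inner_toLp hT, L2.inner_def]
    refine integral_congr_ae ?_
    filter_upwards [hS.memLp.coeFn_toLp, hT.memLp.coeFn_toLp] with z hz1 hz2
    rw [hz1, hz2]
    rfl
  unfold hsMeasure at h1 h2
  have h3 : (fun l => ∫ i, (inner ℂ (S l (hsBasis d i)) (T l (hsBasis d i)) : ℂ) ∂Measure.count)
      =ᵐ[plancherelMeasure d] fun l => hsInner (T l) (S l) := by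
    filter_upwards [h1.prod_right_ae] with l hl
    rw [integral_count_eq_tsum hl]
    rfl
  have h4 : Integrable (fun l => hsInner (T l) (S l)) (plancherelMeasure d) :=
    h1.integral_prod_left.congr h3
  rw [integral_prod _ h1, integral_congr_ae h3] at h2
  rw [plancherelMeasure, integrable_withDensity_iff_integrable_smul'
    (measurable_plancherelDensity d) (ae_of_all _ fun _ => ENNReal.ofReal_lt_top)] at h4
  rw [plancherelMeasure, integral_withDensity_eq_integral_toReal_smul
    (measurable_plancherelDensity d) (ae_of_all _ fun _ => ENNReal.ofReal_lt_top)] at h2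
  have e : (fun l : ℝ => hsInner (T l) (S l) * ((|l| ^ d : ℝ) : ℂ)) =
      fun l => (ENNReal.ofReal (|l| ^ d)).toReal • hsInner (T l) (S l) := by
    funext l
    rw [ENNReal.toReal_ofReal (by positivity), Complex.real_smul, mul_comm]
  rw [e]
  exact ⟨h4, h2⟩

theorem lintegral_eq_lintegral_tsum_add_int {g : ℝ → ℝ≥0∞} (hg : AEMeasurable g) :
    ∫⁻ l, g l = ∫⁻ α in Ioc (0 : ℝ) 1, ∑' j : ℤ, g (α + j) := by
  rw [lintegral_tsum (f := fun (j : ℤ) α => g (α + j)) fun j =>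
      (hg.comp_quasiMeasurePreserving (quasiMeasurePreserving_add_right volume (j : ℝ))).restrict,
    ← setLIntegral_univ, ← iUnion_Ioc_add_intCast (0 : ℝ),
    lintegral_iUnion (fun _ => measurableSet_Ioc) (pairwise_disjoint_Ioc_add_intCast (0 : ℝ))]
  congr 1
  funext j
  rw [← (measurePreserving_add_right volume (j : ℝ)).setLIntegral_comp_preimage_emb
    (measurableEmbedding_addRight (j : ℝ))]
  congr 2
  ext x
  simp only [zero_add, preimage_add_const_Ioc, sub_self]
  rw [add_sub_cancel_left]

theorem integral_eq_integral_tsum_add_int {g : ℝ → ℂ} (hg : Integrable g) :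
    ∫ l, g l = ∫ α in Ioc (0 : ℝ) 1, ∑' j : ℤ, g (α + j) := by
  have hfin := lintegral_eq_lintegral_tsum_add_int hg.1.enorm
  have hm : ∀ j : ℤ, AEStronglyMeasurable (fun α => g (α + j)) (volume.restrict (Ioc (0 : ℝ) 1)) :=
    fun j => (hg.comp_add_right (j : ℝ)).1.restrict
  rw [lintegral_tsum fun j => (hm j).enorm] at hfin
  rw [integral_tsum hm (by rw [← hfin]; exact hg.2.ne),
    ← hg.hasSum_intervalIntegral_comp_add_int.tsum_eq]
  simp only [intervalIntegral.integral_of_le zero_le_one]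

/-- The Fourier coefficients of the bracket are inner products with central translates. -/
theorem inner_leftTranslate_central_eq_integral (φ ψ : L2Heis d) (k : ℤ) :
    inner ℂ ψ (leftTranslate (Heis.mk 0 0 k) φ) =
      ∫ α in Ioc (0 : ℝ) 1, centralChar k α * bracket φ ψ α := by
  obtain ⟨h1, h2⟩ := ((isFourierTransform_heisFourier φ).leftTranslate_central k).integral_hsInner
    (isFourierTransform_heisFourier ψ)
  rw [← h2, integral_eq_integral_tsum_add_int h1]
  congr 1
  funext α
  rw [bracket, ← tsum_mul_left]
  congr 1
  funext j
  rw [hsInner_smul_left, centralChar_add_int, mul_assoc]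

/-- The bracket `[ψ, ψ]` as a function with values in `[0, ∞]`. -/
def bracketWeight (ψ : L2Heis d) (α : ℝ) : ℝ≥0∞ :=
  ∑' j : ℤ, hsNormSq (fun f => heisFourier ψ (α + j) f) * ENNReal.ofReal (|α + j| ^ d)

theorem IsFourierTransform.aemeasurable_hsNormSq {φ : L2Heis d}
    {T : ℝ → L2Euc d →L[ℂ] L2Euc d} (h : IsFourierTransform φ T) :
    AEMeasurable fun l => hsNormSq fun f => T l f :=
  AEMeasurable.tsum fun i => (h.1 (hsBasis d i)).enorm.pow_const 2

theorem norm_sum_eq_of_inner_eq {ι H K : Type*} [NormedAddCommGroup H] [InnerProductSpace ℂ H]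
    [NormedAddCommGroup K] [InnerProductSpace ℂ K] {x : ι → H} {y : ι → K}
    (h : ∀ i j, (inner ℂ (x i) (x j) : ℂ) = inner ℂ (y i) (y j)) (s : Finset ι) (c : ι → ℂ) :
    ‖∑ i ∈ s, c i • x i‖ = ‖∑ i ∈ s, c i • y i‖ := by
  have h2 : (inner ℂ (∑ i ∈ s, c i • x i) (∑ i ∈ s, c i • x i) : ℂ) =
      inner ℂ (∑ i ∈ s, c i • y i) (∑ i ∈ s, c i • y i) := by
    simp only [sum_inner, inner_sum, inner_smul_left, inner_smul_right, h]
  rw [inner_self_eq_norm_sq_to_K, inner_self_eq_norm_sq_to_K] at h2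
  have h3 : ‖∑ i ∈ s, c i • x i‖ ^ 2 = ‖∑ i ∈ s, c i • y i‖ ^ 2 := by exact_mod_cast h2
  exact (sq_eq_sq₀ (norm_nonneg _) (norm_nonneg _)).1 h3

/-- The norm of a combination of central translates in terms of the bracket. -/
theorem enorm_sum_central_sq (ψ : L2Heis d) (s : Finset ℤ) (c : ℤ → ℂ) :
    ‖∑ k ∈ s, c k • leftTranslate (Heis.mk 0 0 (k : ℝ)) ψ‖ₑ ^ 2 =
      ∫⁻ α in Ioc (0 : ℝ) 1, ‖∑ k ∈ s, c k * centralChar k α‖ₑ ^ 2 * bracketWeight ψ α := by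
  set T := heisFourier ψ with hT
  have hψ : IsFourierTransform ψ T := isFourierTransform_heisFourier ψ
  have hk := fun k : ℤ => hψ.leftTranslate_central (k : ℝ)
  -- The translates and their transforms have the same Gram matrix, so the norm can be computed on
  -- the Fourier side without proving the transform linear.
  have hn := norm_sum_eq_of_inner_eq (x := fun k : ℤ => leftTranslate (Heis.mk 0 0 (k : ℝ)) ψ)
    (y := fun k : ℤ => (hk k).memLp.toLp _) (fun i j => ((hk i).inner_toLp (hk j)).symm) s c
  have hcol : ((∑ k ∈ s, c k • (hk k).memLp.toLp _ : Lp (L2Euc d) 2 (hsMeasure d)) :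
      ℝ × hsIndex d → L2Euc d) =ᵐ[hsMeasure d]
      hsColumns fun l f => (∑ k ∈ s, c k * centralChar k l) • T l f := by
    have h1 : ∀ k ∈ s, (c k • (hk k).memLp.toLp _ : Lp (L2Euc d) 2 (hsMeasure d))
        =ᵐ[hsMeasure d] fun z => c k • centralChar k z.1 • T z.1 (hsBasis d z.2) := fun k _ => by
      filter_upwards [Lp.coeFn_smul (c k) ((hk k).memLp.toLp _), (hk k).memLp.coeFn_toLp]
        with z hz1 hz2
      rw [hz1, Pi.smul_apply, hz2]
      rfl
    refine (Lp.coeFn_finsetSum s _).trans ?_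
    filter_upwards [(s.eventually_all).2 h1] with z hz
    rw [Finset.sum_apply, Finset.sum_congr rfl hz]
    simp only [hsColumns, Finset.sum_smul, smul_smul]
  have hm : AEStronglyMeasurable
      (hsColumns fun l f => (∑ k ∈ s, c k * centralChar k l) • T l f) (hsMeasure d) :=
    (Lp.aestronglyMeasurable _).congr hcol
  have hnn : ‖∑ k ∈ s, c k • leftTranslate (Heis.mk 0 0 (k : ℝ)) ψ‖ₑ =
      ‖∑ k ∈ s, c k • (hk k).memLp.toLp _‖ₑ := by
    rw [← ofReal_norm, hn, ofReal_norm]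
  rw [hnn, Lp.enorm_sq_eq_lintegral]
  rw [lintegral_congr_ae (g := fun z => ‖hsColumns (fun l f =>
    (∑ k ∈ s, c k * centralChar k l) • T l f) z‖ₑ ^ 2)
    (by filter_upwards [hcol] with z hz; rw [hz]), lintegral_hsColumns hm]
  simp only [hsNormSq_smul]
  have hcont : Continuous fun l => ∑ k ∈ s, c k * centralChar k l :=
    continuous_finsetSum _ fun k _ => continuous_const.mul (continuous_centralChar k)
  rw [lintegral_eq_lintegral_tsum_add_int
    (g := fun l => ‖∑ k ∈ s, c k * centralChar k l‖ₑ ^ 2 * hsNormSq (T l) *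
      ENNReal.ofReal (|l| ^ d)) (((hcont.enorm.measurable.pow_const 2).aemeasurable.mul hψ.aemeasurable_hsNormSq).mul
      (measurable_plancherelDensity d).aemeasurable)]
  refine lintegral_congr fun α => ?_
  rw [bracketWeight, ← ENNReal.tsum_mul_left]
  refine tsum_congr fun j => ?_
  simp only [centralChar_add_int, mul_assoc, hT]

theorem aemeasurable_bracketWeight (ψ : L2Heis d) : AEMeasurable (bracketWeight ψ) :=
  AEMeasurable.tsum fun j => (((isFourierTransform_heisFourier ψ).aemeasurable_hsNormSq).mul
    (measurable_plancherelDensity d).aemeasurable).comp_quasiMeasurePreserving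
      (quasiMeasurePreserving_add_right volume (j : ℝ))

/-- Plancherel in folded form; it makes the weight finite almost everywhere, so the complex series
for `[ψ, ψ]` is not a default value there. -/
theorem lintegral_bracketWeight (ψ : L2Heis d) :
    ∫⁻ α in Ioc (0 : ℝ) 1, bracketWeight ψ α = ‖ψ‖ₑ ^ 2 := by
  have h := enorm_sum_central_sq ψ {0} fun _ => 1
  have h0 : leftTranslate (Heis.mk 0 0 ((0 : ℤ) : ℝ)) ψ = ψ := by
    rw [Int.cast_zero]
    exact leftTranslate_one ψ
  rw [Finset.sum_singleton, one_smul, h0] at h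
  rw [h]
  refine lintegral_congr fun α => ?_
  rw [Finset.sum_singleton, one_mul, ← ofReal_norm, norm_centralChar]
  simp

theorem ae_bracketWeight_lt_top (ψ : L2Heis d) :
    ∀ᵐ α ∂(volume.restrict (Ioc (0 : ℝ) 1)), bracketWeight ψ α < ∞ :=
  ae_lt_top' (aemeasurable_bracketWeight ψ).restrict
    (by rw [lintegral_bracketWeight]; exact ENNReal.pow_ne_top enorm_ne_top)

theorem bracket_self {ψ : L2Heis d} {α : ℝ} (h : bracketWeight ψ α ≠ ∞) :
    bracket ψ ψ α = ((bracketWeight ψ α).toReal : ℂ) := by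
  rw [bracketWeight, ENNReal.tsum_toReal_eq fun j => ENNReal.ne_top_of_tsum_ne_top h j,
    Complex.ofReal_tsum, bracket]
  congr 1
  funext j
  rw [hsInner_self, ENNReal.toReal_mul, ENNReal.toReal_ofReal (by positivity), Complex.ofReal_mul]

theorem bracketWeight_eq_ofReal (ψ : L2Heis d) :
    ∀ᵐ α ∂(volume.restrict (Ioc (0 : ℝ) 1)),
      bracketWeight ψ α = ENNReal.ofReal (bracket ψ ψ α).re := by
  filter_upwards [ae_bracketWeight_lt_top ψ] with α hα
  rw [bracket_self hα.ne, Complex.ofReal_re, ENNReal.ofReal_toReal hα.ne]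

/-- Covers the points outside `E_ψ`, about which the orthogonality hypothesis says nothing: there
every weighted term of the series is zero. -/
theorem bracket_eq_zero_of_bracketWeight_eq_zero {ψ : L2Heis d} (φ : L2Heis d) {α : ℝ}
    (h : bracketWeight ψ α = 0) : bracket ψ φ α = 0 := by
  rw [bracketWeight, ENNReal.tsum_eq_zero] at h
  rw [bracket]
  convert tsum_zero with j
  rcases mul_eq_zero.1 (h j) with h1 | h1
  · rw [hsNormSq, ENNReal.tsum_eq_zero] at h1
    have h2 : ∀ i, heisFourier ψ (α + j) (hsBasis d i) = 0 := fun i => by simpa using h1 i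
    simp [hsInner, h2]
  · rw [ENNReal.ofReal_eq_zero] at h1
    have h2 : |α + j| ^ d = 0 := le_antisymm h1 (by positivity)
    rw [h2, Complex.ofReal_zero, mul_zero]

/-- The inner product is a Fourier coefficient of a bracket that vanishes almost everywhere on `(0,
1]`. -/
theorem inner_leftTranslate_central_eq_zero {ψ φ : L2Heis d}
    (h : ∀ᵐ α : ℝ, α ∈ bracketSupport ψ → bracket ψ φ α = 0) (k : ℤ) :
    inner ℂ φ (leftTranslate (Heis.mk 0 0 k) ψ) = 0 := by
  rw [inner_leftTranslate_central_eq_integral]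
  refine integral_eq_zero_of_ae ?_
  filter_upwards [bracketWeight_eq_ofReal ψ, ae_restrict_of_ae h,
    ae_restrict_mem measurableSet_Ioc] with α h1 h2 h3
  rw [Pi.zero_apply]
  by_cases hα : 0 < (bracket ψ ψ α).re
  · rw [h2 ⟨h3, hα⟩, mul_zero]
  · rw [ENNReal.ofReal_of_nonpos (not_lt.1 hα)] at h1
    rw [bracket_eq_zero_of_bracketWeight_eq_zero φ h1, mul_zero]

end
end

/-! ### Riesz bases and inequalities for finite sums -/

noncomputable section

section RieszBasis

variable {ι H : Type*} [NormedAddCommGroup H] [InnerProductSpace ℂ H]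

/-- The Riesz inequalities for finite linear combinations. -/
def FiniteRieszBounds (a b : ℝ) (v : ι → H) : Prop :=
  ∀ (s : Finset ι) (c : ι → ℂ), a * ∑ i ∈ s, ‖c i‖ ^ 2 ≤ ‖∑ i ∈ s, c i • v i‖ ^ 2 ∧
    ‖∑ i ∈ s, c i • v i‖ ^ 2 ≤ b * ∑ i ∈ s, ‖c i‖ ^ 2

theorem IsRieszBasisOfSpan.finiteRieszBounds {a b : ℝ} {v : ι → H}
    (h : IsRieszBasisOfSpan a b v) : FiniteRieszBounds a b v := by
  classical
  intro s c
  set c' : ι → ℂ := fun i => if i ∈ s then c i else 0 with hc'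
  have h0 : ∀ i ∉ s, ‖c' i‖ ^ 2 = 0 := fun i hi => by simp [hc', hi]
  have h1 : ∀ i ∉ s, c' i • v i = 0 := fun i hi => by simp [hc', hi]
  have h2 := (h.2 c' (summable_of_ne_finset_zero h0)).2
  rw [tsum_eq_sum h0, tsum_eq_sum h1] at h2
  have e1 : ∑ i ∈ s, ‖c' i‖ ^ 2 = ∑ i ∈ s, ‖c i‖ ^ 2 :=
    Finset.sum_congr rfl fun i hi => by simp [hc', hi]
  have e2 : ∑ i ∈ s, c' i • v i = ∑ i ∈ s, c i • v i :=
    Finset.sum_congr rfl fun i hi => by simp [hc', hi]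
  rwa [e1, e2] at h2

theorem FiniteRieszBounds.summable [CompleteSpace H] {a b : ℝ} {v : ι → H}
    (h : FiniteRieszBounds a b v) {c : ι → ℂ} (hc : Summable fun i => ‖c i‖ ^ 2) :
    Summable fun i => c i • v i := by
  rw [summable_iff_vanishing_norm] at hc ⊢
  intro ε hε
  -- No sign of `b` is assumed; the shift provides a positive denominator in the Cauchy criterion.
  have hb : 0 < |b| + 1 := by positivity
  obtain ⟨s, hs⟩ := hc (ε ^ 2 / (|b| + 1)) (by positivity)
  refine ⟨s, fun t ht => ?_⟩
  have h1 := hs t ht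
  rw [Real.norm_of_nonneg (Finset.sum_nonneg fun i _ => by positivity), lt_div_iff₀ hb] at h1
  have h2 := (h t c).2
  have h3 : 0 ≤ ∑ i ∈ t, ‖c i‖ ^ 2 := Finset.sum_nonneg fun i _ => by positivity
  refine lt_of_pow_lt_pow_left₀ 2 hε.le ?_
  nlinarith [le_abs_self b]

theorem FiniteRieszBounds.tsum_bounds [CompleteSpace H] {a b : ℝ} {v : ι → H}
    (h : FiniteRieszBounds a b v) {c : ι → ℂ} (hc : Summable fun i => ‖c i‖ ^ 2) :
    a * ∑' i, ‖c i‖ ^ 2 ≤ ‖∑' i, c i • v i‖ ^ 2 ∧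
      ‖∑' i, c i • v i‖ ^ 2 ≤ b * ∑' i, ‖c i‖ ^ 2 := by
  have h1 : Tendsto (fun s : Finset ι => ‖∑ i ∈ s, c i • v i‖ ^ 2) atTop
      (𝓝 (‖∑' i, c i • v i‖ ^ 2)) := ((h.summable hc).hasSum.norm).pow 2
  have h2 : Tendsto (fun s : Finset ι => ∑ i ∈ s, ‖c i‖ ^ 2) atTop
      (𝓝 (∑' i, ‖c i‖ ^ 2)) := hc.hasSum
  exact ⟨le_of_tendsto_of_tendsto' (h2.const_mul a) h1 fun s => (h s c).1,
    le_of_tendsto_of_tendsto' h1 (h2.const_mul b) fun s => (h s c).2⟩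

/-- The synthesis map `c ↦ ∑ cᵢ vᵢ` from `ℓ²` is bounded, and the lower inequality makes it
injective with closed range. The range contains every `v i`, so it is the whole closed span; the
coordinates of the inverse map are the biorthogonal functionals. -/
theorem FiniteRieszBounds.exists_basis [CompleteSpace H] {a b : ℝ} (ha : 0 < a) {v : ι → H}
    (h : FiniteRieszBounds a b v) :
    ∃ e : UnconditionalSchauderBasis ι ℂ (Submodule.span ℂ (range v)).topologicalClosure,
      ∀ i, ((e i : (Submodule.span ℂ (range v)).topologicalClosure) : H) = v i := by
  classical
  set X := (Submodule.span ℂ (range v)).topologicalClosure with hX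
  have hsq : ∀ c : lp (fun _ : ι => ℂ) 2, Summable (fun i => ‖c i‖ ^ 2) ∧
      ∑' i, ‖c i‖ ^ 2 = ‖c‖ ^ 2 := by
    intro c
    have h1 := lp.hasSum_norm (p := 2) (by norm_num) c
    simp only [ENNReal.toReal_ofNat, Real.rpow_ofNat] at h1
    exact ⟨h1.summable, h1.tsum_eq⟩
  have hvX : ∀ i, v i ∈ X := fun i =>
    Submodule.le_topologicalClosure _ (Submodule.subset_span (mem_range_self i))
  have hmem : ∀ c : lp (fun _ : ι => ℂ) 2, ∑' i, c i • v i ∈ X := by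
    intro c
    refine (Submodule.isClosed_topologicalClosure _).mem_of_tendsto
      (h.summable (hsq c).1).hasSum (Eventually.of_forall fun s => ?_)
    exact Submodule.sum_mem _ fun i _ => Submodule.smul_mem _ _ (hvX i)
  let R₀ : lp (fun _ : ι => ℂ) 2 →ₗ[ℂ] X :=
    { toFun := fun c => ⟨∑' i, c i • v i, hmem c⟩
      map_add' := fun c c' => by
        refine Subtype.ext ?_
        rw [Submodule.coe_add, ← (h.summable (hsq c).1).tsum_add (h.summable (hsq c').1)]
        simp only [lp.coeFn_add, Pi.add_apply, add_smul]
      map_smul' := fun k c => by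
        refine Subtype.ext ?_
        rw [RingHom.id_apply, Submodule.coe_smul, ← tsum_const_smul'']
        simp only [lp.coeFn_smul, Pi.smul_apply, smul_smul, smul_eq_mul] }
  have hR₀ : ∀ c, ((R₀ c : X) : H) = ∑' i, c i • v i := fun c => rfl
  let R : lp (fun _ : ι => ℂ) 2 →L[ℂ] X := R₀.mkContinuous (√|b|) fun c => by
    rw [Submodule.coe_norm, hR₀]
    have h1 := (h.tsum_bounds (hsq c).1).2
    rw [(hsq c).2] at h1
    rw [← Real.sqrt_sq (norm_nonneg c), ← Real.sqrt_mul (abs_nonneg b)]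
    refine Real.le_sqrt_of_sq_le (h1.trans ?_)
    gcongr
    exact le_abs_self b
  have hR : ∀ c, ((R c : X) : H) = ∑' i, c i • v i := fun c => rfl
  have hlow : ∀ c, ‖c‖ ≤ (√a)⁻¹ * ‖R c‖ := by
    intro c
    have h1 := (h.tsum_bounds (hsq c).1).1
    rw [(hsq c).2, ← hR, ← Submodule.coe_norm] at h1
    rw [← div_eq_inv_mul, le_div_iff₀ (Real.sqrt_pos.2 ha)]
    refine le_of_sq_le_sq ?_ (norm_nonneg _)
    rw [mul_pow, Real.sq_sqrt ha.le]
    linarith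
  have hanti : AntilipschitzWith (Real.toNNReal (√a)⁻¹) R := by
    refine ContinuousLinearMap.antilipschitz_of_bound R fun c => ?_
    rw [Real.coe_toNNReal _ (by positivity)]
    exact hlow c
  have hsingle : ∀ i, R (lp.single 2 i 1) = ⟨v i, hvX i⟩ := by
    intro i
    refine Subtype.ext ?_
    rw [hR, tsum_eq_single i fun j hj => ?_]
    · rw [lp.single_apply_self, one_smul]
    · rw [lp.single_apply_ne _ _ _ hj, zero_smul]
  have hsurj : LinearMap.range (R : lp (fun _ : ι => ℂ) 2 →ₗ[ℂ] X) = ⊤ := by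
    have hcl : IsClosed (range R) := hanti.isClosed_range R.uniformContinuous
    have hcl2 : IsClosed (Subtype.val '' range R : Set H) :=
      (Submodule.isClosed_topologicalClosure _).isClosedEmbedding_subtypeVal.isClosedMap _ hcl
    have hle : X ≤ (LinearMap.range (R : lp (fun _ : ι => ℂ) 2 →ₗ[ℂ] X)).map X.subtype := by
      refine Submodule.topologicalClosure_minimal _ ?_ ?_
      · rw [Submodule.span_le]
        rintro _ ⟨i, rfl⟩
        exact ⟨⟨v i, hvX i⟩, ⟨_, hsingle i⟩, rfl⟩
      · convert hcl2 using 1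
        ext x
        simp
    rw [eq_top_iff]
    rintro ⟨x, hx⟩ -
    obtain ⟨y, hy, hyx⟩ := hle hx
    have : y = ⟨x, hx⟩ := Subtype.ext hyx
    rwa [← this]
  let L : lp (fun _ : ι => ℂ) 2 ≃L[ℂ] X :=
    ContinuousLinearEquiv.ofBijective R (LinearMap.ker_eq_bot.2 hanti.injective) hsurj
  have hL : ∀ c, L c = R c := fun c => rfl
  refine ⟨⟨fun i => ⟨v i, hvX i⟩,
    fun i => (lp.evalCLM ℂ (fun _ : ι => ℂ) 2 i).comp (L.symm : X →L[ℂ] lp (fun _ : ι => ℂ) 2),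
    fun i j => ?_, fun x => ?_⟩, fun i => rfl⟩
  · have : L.symm ⟨v j, hvX j⟩ = lp.single 2 j 1 := by
      rw [ContinuousLinearEquiv.symm_apply_eq, hL, hsingle]
    change L.symm ⟨v j, hvX j⟩ i = _
    rw [this, lp.single_apply]
  · obtain ⟨c, rfl⟩ := L.surjective x
    have h1 : HasSum (fun i => c i • v i) ((L c : X) : H) := (h.summable (hsq c).1).hasSum
    have h2 : HasSum (fun i => c i • (⟨v i, hvX i⟩ : X)) (L c) := by
      rw [HasSum, tendsto_subtype_rng]
      refine h1.congr fun s => ?_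
      rw [Submodule.coe_sum]
      rfl
    have h3 : ∀ i, ((lp.evalCLM ℂ (fun _ : ι => ℂ) 2 i).comp
        (L.symm : X →L[ℂ] lp (fun _ : ι => ℂ) 2)) (L c) = c i := fun i => by
      change L.symm (L c) i = c i
      rw [L.symm_apply_apply]
    simp only [h3]
    exact h2

/-- A family is a Riesz basis of its closed span if and only if it satisfies the Riesz
inequalities for finite linear combinations. -/
theorem isRieszBasisOfSpan_iff_finiteRieszBounds [CompleteSpace H] {a b : ℝ} (ha : 0 < a)
    {v : ι → H} : IsRieszBasisOfSpan a b v ↔ FiniteRieszBounds a b v :=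
  ⟨IsRieszBasisOfSpan.finiteRieszBounds, fun h => ⟨h.exists_basis ha, fun _ hc =>
    ⟨h.summable hc, h.tsum_bounds hc⟩⟩⟩

theorem FiniteRieszBounds.comp_injective {κ : Type*} {a b : ℝ} {v : ι → H}
    (h : FiniteRieszBounds a b v) {f : κ → ι} (hf : Function.Injective f) :
    FiniteRieszBounds a b (v ∘ f) := by
  intro s c
  have h1 := h (s.map ⟨f, hf⟩) (Function.extend f c 0)
  simpa [Finset.sum_map, hf.extend_apply] using h1

theorem norm_sum_sq_of_pairwise_inner_eq_zero {y : ι → H} (s : Finset ι)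
    (h : ∀ i j, i ≠ j → (inner ℂ (y i) (y j) : ℂ) = 0) :
    ‖∑ i ∈ s, y i‖ ^ 2 = ∑ i ∈ s, ‖y i‖ ^ 2 := by
  have h1 : (inner ℂ (∑ i ∈ s, y i) (∑ i ∈ s, y i) : ℂ) = ∑ i ∈ s, inner ℂ (y i) (y i) := by
    rw [sum_inner]
    refine Finset.sum_congr rfl fun i hi => ?_
    rw [inner_sum]
    exact Finset.sum_eq_single_of_mem i hi fun j _ hj => h i j hj.symm
  simp only [inner_self_eq_norm_sq_to_K] at h1
  exact_mod_cast h1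

/-- A family indexed by a product satisfies the Riesz inequalities if its rows do, and different
rows are orthogonal. -/
theorem FiniteRieszBounds.of_orthogonal_rows {κ : Type*} {a b : ℝ} {v : ι × κ → H}
    (hrow : ∀ i, FiniteRieszBounds a b fun k => v (i, k))
    (hort : ∀ i j, i ≠ j → ∀ k k', (inner ℂ (v (i, k)) (v (j, k')) : ℂ) = 0) :
    FiniteRieszBounds a b v := by
  classical
  intro s c
  -- Padding the coefficients by zero turns `s` into a rectangle, whose rows can be treated
  -- separately.
  set I := s.image Prod.fst
  set K := s.image Prod.snd
  have hsub : s ⊆ I ×ˢ K := fun x hx => Finset.mem_product.2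
    ⟨Finset.mem_image_of_mem _ hx, Finset.mem_image_of_mem _ hx⟩
  set c' : ι × κ → ℂ := fun x => if x ∈ s then c x else 0 with hc'
  have e1 : ∑ x ∈ s, ‖c x‖ ^ 2 = ∑ i ∈ I, ∑ k ∈ K, ‖c' (i, k)‖ ^ 2 := by
    rw [← Finset.sum_product' I K fun i k => ‖c' (i, k)‖ ^ 2,
      ← Finset.sum_subset hsub fun x _ hx => by simp [hc', hx]]
    exact Finset.sum_congr rfl fun x hx => by simp [hc', hx]
  have e2 : ∑ x ∈ s, c x • v x = ∑ i ∈ I, ∑ k ∈ K, c' (i, k) • v (i, k) := by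
    rw [← Finset.sum_product' I K fun i k => c' (i, k) • v (i, k),
      ← Finset.sum_subset hsub fun x _ hx => by simp [hc', hx]]
    exact Finset.sum_congr rfl fun x hx => by simp [hc', hx]
  rw [e1, e2, norm_sum_sq_of_pairwise_inner_eq_zero, Finset.mul_sum, Finset.mul_sum]
  · exact ⟨Finset.sum_le_sum fun i _ => (hrow i K fun k => c' (i, k)).1,
      Finset.sum_le_sum fun i _ => (hrow i K fun k => c' (i, k)).2⟩
  · intro i j hij
    rw [sum_inner]
    refine Finset.sum_eq_zero fun k _ => ?_
    rw [inner_sum]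
    refine Finset.sum_eq_zero fun k' _ => ?_
    rw [inner_smul_left, inner_smul_right, hort i j hij, mul_zero, mul_zero]

end RieszBasis
end

/-! ### Trigonometric polynomials and positivity of integrable functions -/

noncomputable section

section TrigonometricPolynomials

theorem continuous_sum_centralChar (s : Finset ℤ) (c : ℤ → ℂ) :
    Continuous fun α => ∑ k ∈ s, c k * centralChar k α :=
  continuous_finsetSum _ fun k _ => continuous_const.mul (continuous_centralChar k)

theorem norm_sum_centralChar_le (s : Finset ℤ) (c : ℤ → ℂ) (α : ℝ) :
    ‖∑ k ∈ s, c k * centralChar k α‖ ≤ ∑ k ∈ s, ‖c k‖ := by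
  refine (norm_sum_le _ _).trans_eq (Finset.sum_congr rfl fun k _ => ?_)
  rw [norm_mul, norm_centralChar, mul_one]

theorem Integrable.norm_sum_centralChar_sq_mul {h : ℝ → ℝ} {μ : Measure ℝ} (hh : Integrable h μ)
    (s : Finset ℤ) (c : ℤ → ℂ) :
    Integrable (fun α => ‖∑ k ∈ s, c k * centralChar k α‖ ^ 2 * h α) μ := by
  refine hh.bdd_mul (c := (∑ k ∈ s, ‖c k‖) ^ 2)
    ((continuous_sum_centralChar s c).norm.pow 2).aestronglyMeasurable (ae_of_all _ fun α => ?_)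
  rw [Real.norm_of_nonneg (by positivity)]
  gcongr
  exact norm_sum_centralChar_le s c α

theorem fourier_coe_eq_centralChar (k : ℤ) (α : ℝ) :
    fourier k (α : AddCircle (1 : ℝ)) = centralChar k α := by
  rw [fourier_coe_apply, centralChar]
  congr 1
  push_cast
  ring

theorem integral_centralChar (k : ℤ) :
    ∫ α in Ioc (0 : ℝ) 1, centralChar k α = if k = 0 then 1 else 0 := by
  split_ifs with hk
  · simp [hk, centralChar]
  · have hc : (2 * Real.pi * k * Complex.I : ℂ) ≠ 0 := by
      simp [hk, Real.pi_ne_zero]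
    have e : ∀ α : ℝ, centralChar k α = Complex.exp ((2 * Real.pi * k * Complex.I) * α) := by
      intro α
      rw [centralChar]
      congr 1
      push_cast
      ring
    rw [← intervalIntegral.integral_of_le zero_le_one]
    simp only [e]
    rw [integral_exp_mul_complex hc]
    have : Complex.exp (2 * Real.pi * k * Complex.I * ((1 : ℝ) : ℂ)) = 1 := by
      rw [Complex.exp_eq_one_iff]
      exact ⟨k, by push_cast; ring⟩
    rw [this]
    simp

theorem integral_norm_sum_centralChar_sq (s : Finset ℤ) (c : ℤ → ℂ) :
    ∫ α in Ioc (0 : ℝ) 1, ‖∑ k ∈ s, c k * centralChar k α‖ ^ 2 = ∑ k ∈ s, ‖c k‖ ^ 2 := by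
  have hint : ∀ k : ℤ, Integrable (centralChar k) (volume.restrict (Ioc (0 : ℝ) 1)) := fun k =>
    ((continuous_centralChar k).integrableOn_Icc).mono_set Ioc_subset_Icc_self
  have e : ∀ α, ((‖∑ k ∈ s, c k * centralChar k α‖ ^ 2 : ℝ) : ℂ) =
      ∑ i ∈ s, ∑ j ∈ s, (starRingEnd ℂ (c i) * c j) * centralChar ((j - i : ℤ) : ℝ) α := by
    intro α
    rw [Complex.ofReal_pow, ← Complex.conj_mul', map_sum, Finset.sum_mul_sum]
    refine Finset.sum_congr rfl fun i _ => Finset.sum_congr rfl fun j _ => ?_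
    have : centralChar ((j - i : ℤ) : ℝ) α = starRingEnd ℂ (centralChar i α) * centralChar j α := by
      rw [centralChar, centralChar, centralChar, ← Complex.exp_conj, ← Complex.exp_add, map_mul,
        Complex.conj_I, Complex.conj_ofReal]
      congr 1
      push_cast
      ring
    rw [this, map_mul]
    ring
  have h1 : ((∫ α in Ioc (0 : ℝ) 1, ‖∑ k ∈ s, c k * centralChar k α‖ ^ 2 : ℝ) : ℂ) =
      ((∑ k ∈ s, ‖c k‖ ^ 2 : ℝ) : ℂ) := by
    rw [← integral_complex_ofReal]
    simp only [e]
    rw [integral_finsetSum _ fun i _ => integrable_finsetSum _ fun j _ => (hint _).const_mul _]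
    rw [Complex.ofReal_sum]
    refine Finset.sum_congr rfl fun i hi => ?_
    rw [integral_finsetSum _ fun j _ => (hint _).const_mul _]
    simp only [integral_const_mul, integral_centralChar]
    rw [Finset.sum_eq_single_of_mem i hi fun j _ hj => by simp [sub_ne_zero.2 hj]]
    rw [sub_self, if_pos rfl, mul_one, Complex.conj_mul', Complex.ofReal_pow]
  exact_mod_cast h1

/-- Trigonometric polynomials are uniformly dense in the continuous functions on the circle; the
uniform bound and pointwise convergence are what dominated convergence needs. -/
theorem exists_seq_sum_centralChar_tendsto (g : C(AddCircle (1 : ℝ), ℂ)) :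
    ∃ (s : ℕ → Finset ℤ) (c : ℕ → ℤ → ℂ) (M : ℝ),
      (∀ n (α : ℝ), ‖∑ k ∈ s n, c n k * centralChar k α‖ ≤ M) ∧
      ∀ α : ℝ, Tendsto (fun n => ∑ k ∈ s n, c n k * centralChar k α) atTop
        (𝓝 (g (α : AddCircle (1 : ℝ)))) := by
  have : Fact ((0 : ℝ) < 1) := ⟨zero_lt_one⟩
  have hg : g ∈ (Submodule.span ℂ (range (@fourier (1 : ℝ)))).topologicalClosure := by
    rw [span_fourier_closure_eq_top]
    exact Submodule.mem_top
  obtain ⟨u, hu, hug⟩ := mem_closure_iff_seq_limit.1 hg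
  have hu2 : ∀ n, ∃ c : ℤ →₀ ℂ, (c.sum fun i a => a • fourier (T := (1 : ℝ)) i) = u n := fun n =>
    Finsupp.mem_span_range_iff_exists_finsupp.1 (hu n)
  choose c hc using hu2
  have hval : ∀ n (α : ℝ), ∑ k ∈ (c n).support, c n k * centralChar k α =
      u n (α : AddCircle (1 : ℝ)) := by
    intro n α
    rw [← hc n, Finsupp.sum, ContinuousMap.sum_apply]
    refine Finset.sum_congr rfl fun k _ => ?_
    rw [ContinuousMap.smul_apply, fourier_coe_eq_centralChar, smul_eq_mul]
  obtain ⟨M, hM⟩ := (Metric.isBounded_range_of_tendsto u hug).exists_norm_le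
  refine ⟨fun n => (c n).support, fun n => c n, M, fun n α => ?_, fun α => ?_⟩
  · rw [hval]
    exact ((u n).norm_coe_le_norm _).trans (hM _ (mem_range_self n))
  · simp only [hval]
    exact ((continuous_eval_const (F := C(AddCircle (1 : ℝ), ℂ)) (α : AddCircle (1 : ℝ))).tendsto g).comp hug

/-- An integrable function on `(0, 1]` with nonnegative integrals against all squared moduli of
trigonometric polynomials is nonnegative. -/
theorem ae_nonneg_of_forall_integral_norm_sum_centralChar_sq_mul_nonneg {h : ℝ → ℝ}
    (hh : IntegrableOn h (Ioc 0 1))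
    (hpos : ∀ (s : Finset ℤ) (c : ℤ → ℂ),
      0 ≤ ∫ α in Ioc (0 : ℝ) 1, ‖∑ k ∈ s, c k * centralChar k α‖ ^ 2 * h α) :
    ∀ᵐ α ∂(volume.restrict (Ioc (0 : ℝ) 1)), 0 ≤ h α := by
  have : Fact ((0 : ℝ) < 1) := ⟨zero_lt_one⟩
  have hcont : ∀ g : C(AddCircle (1 : ℝ), ℂ),
      0 ≤ ∫ α in Ioc (0 : ℝ) 1, ‖g (α : AddCircle (1 : ℝ))‖ ^ 2 * h α := by
    intro g
    obtain ⟨s, c, M, hM, hlim⟩ := exists_seq_sum_centralChar_tendsto g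
    refine ge_of_tendsto' (tendsto_integral_of_dominated_convergence (fun α => M ^ 2 * ‖h α‖)
      (fun n => (Integrable.norm_sum_centralChar_sq_mul hh (s n) (c n)).1)
      (hh.norm.const_mul _) (fun n => ae_of_all _ fun α => ?_)
      (ae_of_all _ fun α => (((hlim α).norm.pow 2).mul_const (h α)))) fun n => hpos (s n) (c n)
    rw [norm_mul, Real.norm_of_nonneg (by positivity)]
    gcongr
    exact hM n α
  -- Indicators of compact sets are limits of squared moduli of continuous functions on the circle.
  -- Since `(0, 1]` injects into the circle, membership in `K` can be read off its closed image `F`.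
  have hcompact : ∀ K : Set ℝ, IsCompact K → K ⊆ Ioc 0 1 → 0 ≤ ∫ α in K, h α := by
    intro K hK hKI
    set F : Set (AddCircle (1 : ℝ)) := (↑) '' K with hF
    have hFc : IsClosed F := (hK.image (AddCircle.continuous_mk' (1 : ℝ))).isClosed
    have hmem : ∀ α ∈ Ioc (0 : ℝ) 1, ((α : AddCircle (1 : ℝ)) ∈ F ↔ α ∈ K) := by
      refine fun α hα => ⟨?_, fun hαK => ⟨α, hαK, rfl⟩⟩
      rintro ⟨β, hβ, hβα⟩
      have h1 := (AddCircle.coe_eq_coe_iff_of_mem_Ioc (p := (1 : ℝ)) (a := 0)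
        (by simpa using hKI hβ) (by simpa using hα)).1 hβα
      rwa [← h1]
    have hδ : ∀ n : ℕ, (0 : ℝ) < 1 / ((n : ℝ) + 1) := fun n => by positivity
    have hlim := thickenedIndicator_tendsto_indicator_closure hδ
      tendsto_one_div_add_atTop_nhds_zero_nat F
    rw [hFc.closure_eq, tendsto_pi_nhds] at hlim
    -- The square root makes `‖g n‖ ^ 2` the thickened indicator itself.
    let g : ℕ → C(AddCircle (1 : ℝ), ℂ) := fun n =>
      ⟨fun x => ((√(thickenedIndicator (hδ n) F x : ℝ) : ℝ) : ℂ),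
        Complex.continuous_ofReal.comp (Real.continuous_sqrt.comp
          (NNReal.continuous_coe.comp (thickenedIndicator (hδ n) F).continuous))⟩
    have hg : ∀ n x, ‖g n x‖ ^ 2 = (thickenedIndicator (hδ n) F x : ℝ) := by
      intro n x
      change ‖((√(thickenedIndicator (hδ n) F x : ℝ) : ℝ) : ℂ)‖ ^ 2 = _
      rw [Complex.norm_real, Real.norm_of_nonneg (Real.sqrt_nonneg _), Real.sq_sqrt (by positivity)]
    have e : ∫ α in K, h α = ∫ α in Ioc (0 : ℝ) 1, K.indicator (fun _ => (1 : ℝ)) α * h α := by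
      rw [← integral_indicator hK.measurableSet, ← integral_indicator measurableSet_Ioc]
      congr 1
      funext α
      by_cases hα : α ∈ K
      · simp [hα, hKI hα]
      · simp [indicator, hα]
    rw [e]
    refine ge_of_tendsto' (tendsto_integral_of_dominated_convergence (fun α => ‖h α‖)
      (fun n => ?_) hh.norm (fun n => ae_of_all _ fun α => ?_) ?_) fun n => hcont (g n)
    · refine AEStronglyMeasurable.mul ?_ hh.1
      exact ((((g n).continuous.comp (AddCircle.continuous_mk' (1 : ℝ))).norm).pow
        2).aestronglyMeasurable
    · rw [norm_mul, Real.norm_of_nonneg (by positivity), hg]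
      refine mul_le_of_le_one_left (norm_nonneg _) ?_
      exact_mod_cast thickenedIndicator_le_one (hδ n) F _
    · filter_upwards [ae_restrict_mem measurableSet_Ioc] with α hα
      refine Tendsto.mul_const _ ?_
      simp only [hg]
      have h2 := (NNReal.continuous_coe.tendsto _).comp (hlim (α : AddCircle (1 : ℝ)))
      have h4 : K.indicator (fun _ => (1 : ℝ)) α =
          ((F.indicator (fun _ => (1 : NNReal)) (α : AddCircle (1 : ℝ)) : NNReal) : ℝ) := by
        by_cases hαK : α ∈ K
        · rw [indicator_of_mem hαK, indicator_of_mem ((hmem α hα).2 hαK), NNReal.coe_one]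
        · rw [indicator_of_notMem hαK, indicator_of_notMem (mt (hmem α hα).1 hαK), NNReal.coe_zero]
      rw [h4]
      exact h2
  -- A measurable representative makes the negativity set measurable; were it of positive measure,
  -- inner regularity would give a compact subset contradicting `hcompact`.
  set h' := hh.1.mk h with hh'
  have hm : StronglyMeasurable h' := hh.1.stronglyMeasurable_mk
  have hae : h =ᵐ[volume.restrict (Ioc 0 1)] h' := hh.1.ae_eq_mk
  set N : Set ℝ := {α | h' α < 0} ∩ Ioc 0 1 with hN
  have hNm : MeasurableSet N := (measurableSet_lt hm.measurable measurable_const).inter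
    measurableSet_Ioc
  have hN0 : volume N = 0 := by
    by_contra hne
    obtain ⟨K, hKN, hK, hK0⟩ := hNm.exists_lt_isCompact (pos_iff_ne_zero.2 hne)
    have hKI : K ⊆ Ioc 0 1 := hKN.trans inter_subset_right
    have h1 := hcompact K hK hKI
    rw [setIntegral_congr_ae₀ hK.measurableSet.nullMeasurableSet (g := h')] at h1
    · have hint : IntegrableOn (fun α => -h' α) K :=
        (IntegrableOn.mono_set (hh.congr hae : IntegrableOn h' (Ioc 0 1) volume) hKI).neg
      have h2 : 0 < ∫ α in K, -h' α := by
        rw [setIntegral_pos_iff_support_of_nonneg_ae ?_ hint]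
        · refine hK0.trans_le (measure_mono fun α hα => ⟨?_, hα⟩)
          exact neg_ne_zero.2 (hKN hα).1.ne
        · filter_upwards [ae_restrict_mem hK.measurableSet] with α hα
          exact neg_nonneg.2 (hKN hα).1.le
      rw [integral_neg] at h2
      linarith
    · exact (ae_restrict_iff' measurableSet_Ioc).1 hae |>.mono fun α h3 hα => h3 (hKI hα)
  filter_upwards [hae, ae_restrict_mem measurableSet_Ioc,
    ae_restrict_of_ae (measure_eq_zero_iff_ae_notMem.1 hN0)] with α h1 h2 h3
  rw [h1]
  by_contra hneg
  exact h3 ⟨not_le.1 hneg, h2⟩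

end TrigonometricPolynomials
end

/-! ### Riesz bounds on the center and passage to the lattice -/

noncomputable section

section

variable {d : ℕ}

theorem integrable_bracket_self_re (ψ : L2Heis d) :
    Integrable (fun α => (bracket ψ ψ α).re) (volume.restrict (Ioc (0 : ℝ) 1)) := by
  have h : Integrable (fun α => (bracketWeight ψ α).toReal) (volume.restrict (Ioc (0 : ℝ) 1)) :=
    integrable_toReal_of_lintegral_ne_top (aemeasurable_bracketWeight ψ).restrict
      (by rw [lintegral_bracketWeight]; exact ENNReal.pow_ne_top enorm_ne_top)
  refine h.congr ?_
  filter_upwards [ae_bracketWeight_lt_top ψ] with α hα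
  rw [bracket_self hα.ne, Complex.ofReal_re]

theorem norm_sum_central_sq (ψ : L2Heis d) (s : Finset ℤ) (c : ℤ → ℂ) :
    ‖∑ k ∈ s, c k • leftTranslate (Heis.mk 0 0 (k : ℝ)) ψ‖ ^ 2 =
      ∫ α in Ioc (0 : ℝ) 1, ‖∑ k ∈ s, c k * centralChar k α‖ ^ 2 * (bracket ψ ψ α).re := by
  have hpos : ∀ᵐ α ∂(volume.restrict (Ioc (0 : ℝ) 1)), 0 ≤ (bracket ψ ψ α).re := by
    filter_upwards [ae_bracketWeight_lt_top ψ] with α hα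
    rw [bracket_self hα.ne, Complex.ofReal_re]
    exact ENNReal.toReal_nonneg
  rw [integral_eq_lintegral_of_nonneg_ae
    (by filter_upwards [hpos] with α hα using mul_nonneg (by positivity) hα)
    (Integrable.norm_sum_centralChar_sq_mul (integrable_bracket_self_re ψ) s c).1,
    ← toReal_enorm, ← ENNReal.toReal_pow, enorm_sum_central_sq]
  congr 1
  refine lintegral_congr_ae ?_
  filter_upwards [bracketWeight_eq_ofReal ψ] with α hα
  rw [hα, ENNReal.ofReal_mul (by positivity), ENNReal.ofReal_pow (norm_nonneg _), ofReal_norm]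

/-- The central translates satisfy the Riesz inequalities if and only if the bracket is bounded
above and below. -/
theorem finiteRieszBounds_central_iff (ψ : L2Heis d) (a b : ℝ) :
    FiniteRieszBounds a b (fun k : ℤ => leftTranslate (Heis.mk 0 0 (k : ℝ)) ψ) ↔
      ∀ᵐ α : ℝ, α ∈ Ioc (0 : ℝ) 1 → a ≤ (bracket ψ ψ α).re ∧ (bracket ψ ψ α).re ≤ b := by
  rw [← ae_restrict_iff' measurableSet_Ioc]
  have hw := integrable_bracket_self_re ψ
  have hconst : ∀ r : ℝ, Integrable (fun _ => r) (volume.restrict (Ioc (0 : ℝ) 1)) :=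
    fun r => integrable_const r
  have hmean : ∀ (r : ℝ) (s : Finset ℤ) (c : ℤ → ℂ),
      ∫ α in Ioc (0 : ℝ) 1, ‖∑ k ∈ s, c k * centralChar k α‖ ^ 2 * r =
        r * ∑ k ∈ s, ‖c k‖ ^ 2 := fun r s c => by
    rw [integral_mul_const, integral_norm_sum_centralChar_sq, mul_comm]
  constructor
  · intro h
    have h1 := ae_nonneg_of_forall_integral_norm_sum_centralChar_sq_mul_nonneg
      (h := fun α => (bracket ψ ψ α).re - a) (hw.sub (hconst a)) fun s c => by
        simp only [mul_sub]
        rw [integral_sub (Integrable.norm_sum_centralChar_sq_mul hw s c)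
          (Integrable.norm_sum_centralChar_sq_mul (hconst a) s c), hmean, ← norm_sum_central_sq]
        exact sub_nonneg.2 (h s c).1
    have h2 := ae_nonneg_of_forall_integral_norm_sum_centralChar_sq_mul_nonneg
      (h := fun α => b - (bracket ψ ψ α).re) ((hconst b).sub hw) fun s c => by
        simp only [mul_sub]
        rw [integral_sub (Integrable.norm_sum_centralChar_sq_mul (hconst b) s c)
          (Integrable.norm_sum_centralChar_sq_mul hw s c), hmean, ← norm_sum_central_sq]
        exact sub_nonneg.2 (h s c).2
    filter_upwards [h1, h2] with α h3 h4
    exact ⟨sub_nonneg.1 h3, sub_nonneg.1 h4⟩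
  · intro h s c
    rw [norm_sum_central_sq, ← hmean, ← hmean]
    constructor
    · refine integral_mono_ae (Integrable.norm_sum_centralChar_sq_mul (hconst a) s c)
        (Integrable.norm_sum_centralChar_sq_mul hw s c) ?_
      filter_upwards [h] with α hα
      exact mul_le_mul_of_nonneg_left hα.1 (by positivity)
    · refine integral_mono_ae (Integrable.norm_sum_centralChar_sq_mul hw s c)
        (Integrable.norm_sum_centralChar_sq_mul (hconst b) s c) ?_
      filter_upwards [h] with α hα
      exact mul_le_mul_of_nonneg_left hα.2 (by positivity)

theorem FiniteRieszBounds.map_isometry {ι H K : Type*} [NormedAddCommGroup H]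
    [InnerProductSpace ℂ H] [NormedAddCommGroup K] [InnerProductSpace ℂ K] {a b : ℝ} {v : ι → H}
    (h : FiniteRieszBounds a b v) (L : H →ₗᵢ[ℂ] K) :
    FiniteRieszBounds a b fun i => L (v i) := by
  intro s c
  have : ∑ i ∈ s, c i • L (v i) = L (∑ i ∈ s, c i • v i) := by simp
  rw [this, L.norm_map]
  exact h s c

theorem inner_leftTranslate_leftTranslate (g h h' : Heis d) (ψ φ : L2Heis d) :
    (inner ℂ (leftTranslate (h' * g) ψ) (leftTranslate (h' * h) φ) : ℂ) =
      inner ℂ (leftTranslate g ψ) (leftTranslate h φ) := by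
  rw [leftTranslate_mul, leftTranslate_mul, ← leftTranslateIsometry_apply h' (leftTranslate g ψ),
    ← leftTranslateIsometry_apply h' (leftTranslate h φ), LinearIsometry.inner_map_map]

theorem latticeVec_injective (A : GL (Fin d) ℝ) :
    Function.Injective (latticeVec (A : Matrix (Fin d) (Fin d) ℝ)) := by
  intro m n hmn
  have h1 := Matrix.mulVec_injective_iff_isUnit.2 A.isUnit (WithLp.toLp_injective 2 hmn)
  funext i
  exact_mod_cast congrFun h1 i

/-- The lattice element with coordinates `((m, n), k)`. -/
def latticePoint (A B : Matrix (Fin d) (Fin d) ℝ) (x : ((Fin d → ℤ) × (Fin d → ℤ)) × ℤ) : Heis d :=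
  Heis.mk (latticeVec A x.1.1) (latticeVec B x.1.2) x.2

theorem latticePoint_injective (A B : GL (Fin d) ℝ) :
    Function.Injective (latticePoint (A : Matrix (Fin d) (Fin d) ℝ) B) := by
  rintro ⟨⟨m, n⟩, k⟩ ⟨⟨m', n'⟩, k'⟩ h
  have h1 := latticeVec_injective A (congrArg Heis.p h)
  have h2 := latticeVec_injective B (congrArg Heis.q h)
  have h3 : (k : ℝ) = k' := congrArg Heis.t h
  simp only at h1 h2
  rw [h1, h2, Int.cast_injective h3]

/-- Coordinates on the lattice `Γ`. -/
def latticeEquiv (A B : GL (Fin d) ℝ)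
    (hAB : ∀ i j, ∃ k : ℤ,
      ((A : Matrix (Fin d) (Fin d) ℝ)ᵀ * (B : Matrix (Fin d) (Fin d) ℝ)) i j = k) :
    ((Fin d → ℤ) × (Fin d → ℤ)) × ℤ ≃
      heisLattice (A : Matrix (Fin d) (Fin d) ℝ) (B : Matrix (Fin d) (Fin d) ℝ) hAB :=
  Equiv.ofBijective (fun x => ⟨latticePoint A B x, x.1.1, x.1.2, x.2, rfl⟩)
    ⟨fun x y h => latticePoint_injective A B (congrArg Subtype.val h), by
      rintro ⟨_, m, n, k, rfl⟩
      exact ⟨((m, n), k), rfl⟩⟩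

theorem coe_latticeEquiv (A B : GL (Fin d) ℝ)
    (hAB : ∀ i j, ∃ k : ℤ,
      ((A : Matrix (Fin d) (Fin d) ℝ)ᵀ * (B : Matrix (Fin d) (Fin d) ℝ)) i j = k)
    (x : ((Fin d → ℤ) × (Fin d → ℤ)) × ℤ) :
    (latticeEquiv A B hAB x : Heis d) = latticePoint A B x := rfl

theorem latticePoint_eq_mul (A B : Matrix (Fin d) (Fin d) ℝ) (i : (Fin d → ℤ) × (Fin d → ℤ))
    (k : ℤ) : latticePoint A B (i, k) = latticePoint A B (i, 0) * Heis.mk 0 0 (k : ℝ) := by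
  refine Heis.ext' ?_ ?_ ?_ <;> simp [latticePoint]

/-- Two lattice points are simultaneously translated into `Γ₁` and the center. -/
theorem exists_mul_latticePoint (A B : Matrix (Fin d) (Fin d) ℝ)
    (hAB : ∀ i j, ∃ k : ℤ, (Aᵀ * B) i j = k) (x y : ((Fin d → ℤ) × (Fin d → ℤ)) × ℤ) :
    ∃ (h : Heis d) (n : ℤ), h * latticePoint A B x = latticePoint A B (x.1 - y.1, 0) ∧
      h * latticePoint A B y = Heis.mk 0 0 (n : ℝ) := by
  obtain ⟨c, hc⟩ := inner_latticeVec A B hAB y.1.1 x.1.2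
  obtain ⟨c', hc'⟩ := inner_latticeVec A B hAB y.1.1 y.1.2
  -- The translation is the inverse of the second point up to the center; its central coordinate
  -- cancels that of the first product. Integrality of `Aᵀ B` keeps the other central coordinate an
  -- integer.
  refine ⟨Heis.mk (-latticeVec A y.1.1) (-latticeVec B y.1.2) ((c : ℝ) - x.2),
    y.2 - x.2 + c - c', Heis.ext' ?_ ?_ ?_, Heis.ext' ?_ ?_ ?_⟩
  · simp [latticePoint, sub_eq_add_neg, latticeVec_add, latticeVec_neg, add_comm]
  · simp [latticePoint, sub_eq_add_neg, latticeVec_add, latticeVec_neg, add_comm]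
  · simp [latticePoint, hc]
  · simp [latticePoint]
  · simp [latticePoint]
  · simp [latticePoint, hc']
    ring

end
end

theorem theorem1p3 (d : ℕ) (hd : 1 ≤ d)
    (A B : GL (Fin d) ℝ)
    (hAB : ∀ i j, ∃ k : ℤ,
      ((A : Matrix (Fin d) (Fin d) ℝ)ᵀ * (B : Matrix (Fin d) (Fin d) ℝ)) i j = k)
    (ψ : L2Heis d) (hψ : ψ ≠ 0)
    (hcond : ∀ γ₁ ∈ heisLattice₁ (A : Matrix (Fin d) (Fin d) ℝ) (B : Matrix (Fin d) (Fin d) ℝ),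
      γ₁ ≠ 1 → ∀ᵐ α : ℝ, α ∈ bracketSupport ψ → bracket ψ (leftTranslate γ₁ ψ) α = 0)
    (a b : ℝ) (ha : 0 < a) (hab : a ≤ b) :
    IsRieszBasisOfSpan a b
        (fun γ : heisLattice (A : Matrix (Fin d) (Fin d) ℝ) (B : Matrix (Fin d) (Fin d) ℝ) hAB =>
          leftTranslate (γ : Heis d) ψ) ↔
      ∀ᵐ α : ℝ, α ∈ Ioc (0 : ℝ) 1 →
        a ≤ (bracket ψ ψ α).re ∧ (bracket ψ ψ α).re ≤ b := by
  rw [isRieszBasisOfSpan_iff_finiteRieszBounds ha, ← finiteRieszBounds_central_iff]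
  constructor
  · intro h
    -- The inequalities are restricted to the central elements of the lattice.
    have h1 := h.comp_injective (f := fun k : ℤ => latticeEquiv A B hAB ((0, 0), k))
      fun k k' hk => congrArg Prod.snd ((latticeEquiv A B hAB).injective hk)
    convert h1 using 2 with k
    refine congrArg (fun g => leftTranslate g ψ) (Heis.ext' ?_ ?_ rfl)
    · exact (by simp [latticeVec, ← Pi.zero_def] : (0 : EuclideanSpace ℝ (Fin d)) =
        latticeVec (A : Matrix (Fin d) (Fin d) ℝ) 0)
    · exact (by simp [latticeVec, ← Pi.zero_def] : (0 : EuclideanSpace ℝ (Fin d)) =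
        latticeVec (B : Matrix (Fin d) (Fin d) ℝ) 0)
  · intro h
    have h1 : FiniteRieszBounds a b fun x =>
        leftTranslate (latticePoint (A : Matrix (Fin d) (Fin d) ℝ) B x) ψ := by
      refine FiniteRieszBounds.of_orthogonal_rows (fun i => ?_) fun i j hij k k' => ?_
      -- A row is a coset of the center, hence the image of the central family under one left
      -- translation.
      · convert h.map_isometry
          (leftTranslateIsometry (latticePoint (A : Matrix (Fin d) (Fin d) ℝ) B (i, 0))) using 2
          with k
        rw [latticePoint_eq_mul, leftTranslate_mul, leftTranslateIsometry_apply]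
      · obtain ⟨g, n, h2, h3⟩ := exists_mul_latticePoint (A : Matrix (Fin d) (Fin d) ℝ) B hAB
          (i, k) (j, k')
        -- Translating both vectors by `g` leaves a pair in `Γ₁` and the center; the `Γ₁` element is
        -- nontrivial because the rows differ.
        rw [← inner_leftTranslate_leftTranslate _ _ g, h2, h3]
        refine inner_leftTranslate_central_eq_zero (hcond _ ⟨(i - j).1, (i - j).2, ?_⟩ ?_) n
        · simp [latticePoint]
        · intro h4
          have h5 : latticePoint (A : Matrix (Fin d) (Fin d) ℝ) B (0, 0) = 1 := by
            refine Heis.ext' ?_ ?_ ?_ <;> simp [latticePoint, latticeVec, ← Pi.zero_def]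
          have h6 := latticePoint_injective A B (h4.trans h5.symm)
          exact hij (sub_eq_zero.1 (congrArg Prod.fst h6))
    have h2 := h1.comp_injective (latticeEquiv A B hAB).symm.injective
    have h3 : (fun γ : heisLattice (A : Matrix (Fin d) (Fin d) ℝ) B hAB =>
        leftTranslate (γ : Heis d) ψ) = (fun x =>
          leftTranslate (latticePoint (A : Matrix (Fin d) (Fin d) ℝ) B x) ψ) ∘
            (latticeEquiv A B hAB).symm := by
      funext γ
      rw [Function.comp_apply, ← coe_latticeEquiv A B hAB, Equiv.apply_symm_apply]
    rw [h3]
    exact h2
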